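/- Let $I=[a_1,a_2]$ with $-\infty<a_1<a_2<\infty$, or $I=\mathbb R$. **Norms and data.** For pairs of real functions put $\|(f_1,f_2)\|_B=\sup_B\max(|f_1|,|f_2|)\in[0,\infty]$. Let $\mathcal C_1$ be the set of pairs $(v_0,w_0)$ of continuous functions $I\to\mathbb R$ with $v_0\ge w_0$ and, if $I=[a_1,a_2]$, $v_0=w_0$ at $a_1$ and $a_2$. Let $\mathcal X\subset\mathcal C_1$ be the set of those pairs for which, in addition, $v_0,w_0$ are Lipschitz and have only finitely many local extrema on every finite interval. Let $\mathcal C_2$ be the set of pairs of jointly continuous functions $I\times[0,\infty)\to\mathbb R$. **Solutions.** A pair $(v,w)\in\mathcal C_2$ is called a *solution* if: 1. $v_t=-v_x\mathbf 1_{v>w}$ and $w_t=w_x\mathbf 1_{v>w}$ in the following sense: for every open rectangle $F\subset I\times(0,\infty)$ with sides parallel to the axes, if $v>w$ on $F$ then $v(x+\delta,t+\delta)=v(x,t)$ and $w(x-\delta,t+\delta)=w(x,t)$ whenever the points involved lie in $F$; and if $v=w$ on $F$ then $v(x,t+\delta)=v(x,t)$ and $w(x,t+\delta)=w(x,t)$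 whenever the points involved lie in $F$; 2. $v\ge w$ on $I\times[0,\infty)$; 3. if $I=[a_1,a_2]$ then $v(a_i,t)=w(a_i,t)$ for $i=1,2$ and all $t\ge0$; 4. for all $s\ge 0$ and $x_1<x_2$ with $(x_1,x_2)\subset I$, put $U=\{(x,t):t\ge s,\ x_1+(t-s)<x<x_2-(t-s)\}$; if there are continuous functions $\tilde v\ge\tilde w$ on $U$ which satisfy the equations in the sense of 1 (for rectangles contained in $U$), satisfy $\tilde v>\tilde w$ in the interior of $U$, and equal $v,w$ at time $s$ on $(x_1,x_2)$, then $v=\tilde v$ and $w=\tilde w$ in the interior of $U$. **The solution map on $\mathcal X$.** For $(v_0,w_0)\in\mathcal C_1$ and $b\in\mathbb R$ let $L_b=\{z\in I:v_0(z)\le b\}$ and $H_b=\{z\in I:w_0(z)\ge b\}$ if $I=\mathbb R$, and $L_b=\{z\in I:v_0(z)\le b\}\cup(-\infty,a_1]$ and $H_b=\{z\in I:w_0(z)\ge b\}\cup[a_2,\infty)$ if $I=[a_1,a_2]$. With the conventions $\inf\emptyset=+\infty$ and $\sup\emptyset=-\infty$, let $$\alpha_v(b,x)=\inf\Big\{y\ge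 x:\int_x^y(\mathbf 1_{L_b}-\mathbf 1_{H_b})\,dz<0\Big\},\qquad \alpha_w(b,x)=\sup\Big\{y\le x:\int_y^x(\mathbf 1_{L_b}-\mathbf 1_{H_b})\,dz>0\Big\},$$ $$v_*(x,t)=\inf\{b\in\mathbb R:\ x-t\in L_b,\ t\le(\alpha_v(b,x-t)-(x-t))/2\},$$ $$w_*(x,t)=\sup\{b\in\mathbb R:\ x+t\in H_b,\ t\le(x+t-\alpha_w(b,x+t))/2\}.$$ For $(v_0,w_0)\in\mathcal X$ there is a solution $(v,w)\in\mathcal C_2$ with initial value $(v_0,w_0)$ such that $v=v_*$ and $w=w_*$ at all $(x,t)$ with $x$ in the interior of $I$ and $t\ge0$. By continuity, this determines $(v,w)$. Let $\mathcal T:\mathcal X\to\mathcal C_2$ map $(v_0,w_0)$ to this solution. **Theorem.** (i) If $I=[a_1,a_2]$, then $\mathcal X$ is dense in $\mathcal C_1$ with respect to $\|\cdot\|_I$, and $\mathcal T$ extends to a map $\mathcal T:\mathcal C_1\to\mathcal C_2$ that is 1-Lipschitz: $\|\mathcal T(f)-\mathcal T(g)\|_{I\times[0,\infty)}\le\|f-g\|_I$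 for all $f,g\in\mathcal C_1$. (ii) If $I=\mathbb R$, then $\mathcal T$ extends to a map $\mathcal T:\mathcal C_1\to\mathcal C_2$ such that for every $a>0$ and all $f,g\in\mathcal C_1$, $\|\mathcal T(f)-\mathcal T(g)\|_{[-a,a]\times[0,a)}\le\|f-g\|_{[-2a,2a]}$. (iii) In both cases, these extensions can be chosen so that, for every $f\in\mathcal C_1$, $\mathcal T(f)$ is a solution with initial value $f$. -/

import Mathlib

open Set
open scoped NNReal ENNReal

noncomputable section

namespace FreezingTransport

/-! Throughout, `I` is the space variable's range: `Set.univ` or `Set.Icc a₁ a₂`.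
Its frontier is empty, respectively `{a₁, a₂}`. -/

/-- Space-time `I × [0, ∞)`. -/
abbrev SpaceTime (I : Set ℝ) : Type := I × ℝ≥0

/-- `‖(f₁ - g₁, f₂ - g₂)‖_B`, the supremum over `B` of `max (|f₁ - g₁|, |f₂ - g₂|)`,
as an extended nonnegative number. -/
def supDist {α : Type*} [TopologicalSpace α] (B : Set α) (f g : C(α, ℝ) × C(α, ℝ)) : ℝ≥0∞ :=
  ⨆ x ∈ B, max (edist (f.1 x) (g.1 x)) (edist (f.2 x) (g.2 x))

/-- The space of initial conditions: pairs `(v, w)` of continuous functions on `I` with `v ≥ w`,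
and with `v = w` at the endpoints if `I` is a compact interval. -/
def InitialData (I : Set ℝ) : Set (C(I, ℝ) × C(I, ℝ)) :=
  {f | (∀ x, f.2 x ≤ f.1 x) ∧ ∀ x : I, (x : ℝ) ∈ frontier I → f.1 x = f.2 x}

/-- Initial conditions that are moreover Lipschitz and have finitely many local extrema on every
finite interval. -/
def RegularData (I : Set ℝ) : Set (C(I, ℝ) × C(I, ℝ)) :=
  {f | f ∈ InitialData I ∧
    (∃ K : ℝ≥0, LipschitzWith K f.1 ∧ LipschitzWith K f.2) ∧
    ∀ l r : ℝ, {x : I | (x : ℝ) ∈ Icc l r ∧ (IsLocalExtr f.1 x ∨ IsLocalExtr f.2 x)}.Finite}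

/-- The part of the rectangle `(x₁, x₂) × (t₁, t₂)` that lies in space-time `I × [0, ∞)`. -/
def rect (I : Set ℝ) (x₁ x₂ t₁ t₂ : ℝ) : Set (SpaceTime I) :=
  {p | (p.1 : ℝ) ∈ Ioo x₁ x₂ ∧ (p.2 : ℝ) ∈ Ioo t₁ t₂}

/-- The equations `v_t = - v_x 1_{v > w}`, `w_t = w_x 1_{v > w}` in `G`, in the sense of
characteristics: in every open rectangle contained in `G`, if `v > w` there, then `v` is constant
along lines of slope `1` and `w` along lines of slope `-1`; and if `v = w` there, then `v` and `w`
do not depend on time. -/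
def SatisfiesEquations {I : Set ℝ} (v w : SpaceTime I → ℝ) (G : Set (SpaceTime I)) : Prop :=
  ∀ x₁ x₂ t₁ t₂ : ℝ, Ioo x₁ x₂ ⊆ I → 0 ≤ t₁ → rect I x₁ x₂ t₁ t₂ ⊆ G →
    ((∀ p ∈ rect I x₁ x₂ t₁ t₂, w p < v p) →
      ∀ p ∈ rect I x₁ x₂ t₁ t₂, ∀ q ∈ rect I x₁ x₂ t₁ t₂,
        ((q.1 : ℝ) - p.1 = q.2 - p.2 → v q = v p) ∧
        ((q.1 : ℝ) - p.1 = -((q.2 : ℝ) - p.2) → w q = w p)) ∧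
    ((∀ p ∈ rect I x₁ x₂ t₁ t₂, v p = w p) →
      ∀ p ∈ rect I x₁ x₂ t₁ t₂, ∀ q ∈ rect I x₁ x₂ t₁ t₂,
        q.1 = p.1 → v q = v p ∧ w q = w p)

/-- The triangle `{(x, t) : t ≥ s, x₁ + (t - s) < x < x₂ - (t - s)}`. -/
def triangle (I : Set ℝ) (s x₁ x₂ : ℝ) : Set (SpaceTime I) :=
  {p | s ≤ p.2 ∧ x₁ + (p.2 - s) < p.1 ∧ (p.1 : ℝ) < x₂ - (p.2 - s)}

/-- The selection condition ("a configuration thaws as soon as it can"): if, over a base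
`(x₁, x₂) × {s}`, there is a solution `(v', w')` in the triangle which agrees with `(v, w)` on the
base and satisfies `v' > w'` in the interior of the triangle (that is, at its points with `t > s`),
then `(v, w)` coincides with it there. As the triangle does not meet the frontier of `I`, the
boundary condition plays no role for `(v', w')`. -/
def ThawsWhenPossible {I : Set ℝ} (v w : SpaceTime I → ℝ) : Prop :=
  ∀ s x₁ x₂ : ℝ, 0 ≤ s → x₁ < x₂ → Ioo x₁ x₂ ⊆ I →
    ∀ v' w' : SpaceTime I → ℝ,
      ContinuousOn v' (triangle I s x₁ x₂) → ContinuousOn w' (triangle I s x₁ x₂) →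
      SatisfiesEquations v' w' (triangle I s x₁ x₂) →
      (∀ p ∈ triangle I s x₁ x₂, w' p ≤ v' p) →
      (∀ p ∈ triangle I s x₁ x₂, s < p.2 → w' p < v' p) →
      (∀ p ∈ triangle I s x₁ x₂, (p.2 : ℝ) = s → v' p = v p ∧ w' p = w p) →
      ∀ p ∈ triangle I s x₁ x₂, s < p.2 → v p = v' p ∧ w p = w' p

/-- `u = (v, w)`, a pair of continuous functions on `I × [0, ∞)`, solves the constrained boundary
value problem. -/
structure IsSolution {I : Set ℝ} (u : C(SpaceTime I, ℝ) × C(SpaceTime I, ℝ)) : Prop where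
  equations : SatisfiesEquations u.1 u.2 univ
  constraint : ∀ p, u.2 p ≤ u.1 p
  boundary : ∀ p : SpaceTime I, (p.1 : ℝ) ∈ frontier I → u.1 p = u.2 p
  thaws : ThawsWhenPossible u.1 u.2

/-- `u` has initial value `f`. -/
def HasInitialValue {I : Set ℝ} (u : C(SpaceTime I, ℝ) × C(SpaceTime I, ℝ))
    (f : C(I, ℝ) × C(I, ℝ)) : Prop :=
  ∀ x : I, u.1 (x, 0) = f.1 x ∧ u.2 (x, 0) = f.2 x

/-- `{z ∈ I : v z ≤ b}`, enlarged by `{z ≤ a₁}` if `I = [a₁, a₂]` (the set of lower bounds of `I`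
is empty if `I` is the real line). -/
def lowSet {I : Set ℝ} (v : C(I, ℝ)) (b : ℝ) : Set ℝ :=
  {z | ∃ h : z ∈ I, v ⟨z, h⟩ ≤ b} ∪ lowerBounds I

/-- `{z ∈ I : w z ≥ b}`, enlarged by `{z ≥ a₂}` if `I = [a₁, a₂]`. -/
def highSet {I : Set ℝ} (w : C(I, ℝ)) (b : ℝ) : Set ℝ :=
  {z | ∃ h : z ∈ I, b ≤ w ⟨z, h⟩} ∪ upperBounds I

/-- `∫_x^y (1_{v ≤ b} - 1_{w ≥ b}) dz`, with the enlarged sets. -/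
def balance {I : Set ℝ} (f : C(I, ℝ) × C(I, ℝ)) (b x y : ℝ) : ℝ :=
  ∫ z in x..y, ((lowSet f.1 b).indicator (fun _ => (1 : ℝ)) z
    - (highSet f.2 b).indicator (fun _ => (1 : ℝ)) z)

/-- `α(v, b, x) = inf {y ≥ x : ∫_x^y < 0}`, equal to `+∞` if there is no such `y`. -/
def alphaV {I : Set ℝ} (f : C(I, ℝ) × C(I, ℝ)) (b x : ℝ) : EReal :=
  ⨅ y ∈ {y : ℝ | x ≤ y ∧ balance f b x y < 0}, (y : EReal)

/-- `α(w, b, x) = sup {y ≤ x : ∫_y^x > 0}`, equal to `-∞` if there is no such `y`. -/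
def alphaW {I : Set ℝ} (f : C(I, ℝ) × C(I, ℝ)) (b x : ℝ) : EReal :=
  ⨆ y ∈ {y : ℝ | y ≤ x ∧ 0 < balance f b y x}, (y : EReal)

/-- `A(v, b, t)`: the points `x + t` with `x ∈ lowSet v b` and `t ≤ (α(v, b, x) - x) / 2`. -/
def evolvedLow {I : Set ℝ} (f : C(I, ℝ) × C(I, ℝ)) (b t : ℝ) : Set ℝ :=
  {z | z ∈ I ∧ ∃ x : ℝ, z = x + t ∧ x ∈ lowSet f.1 b ∧ ((x + 2 * t : ℝ) : EReal) ≤ alphaV f b x}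

/-- `A(w, b, t)`: the points `x - t` with `x ∈ highSet w b` and `t ≤ (x - α(w, b, x)) / 2`. -/
def evolvedHigh {I : Set ℝ} (f : C(I, ℝ) × C(I, ℝ)) (b t : ℝ) : Set ℝ :=
  {z | z ∈ I ∧ ∃ x : ℝ, z = x - t ∧ x ∈ highSet f.2 b ∧ alphaW f b x ≤ ((x - 2 * t : ℝ) : EReal)}

/-- `v_*(x, t) = inf {b : x ∈ A(v, b, t)}`. -/
def vStar {I : Set ℝ} (f : C(I, ℝ) × C(I, ℝ)) (x t : ℝ) : EReal :=
  ⨅ b ∈ {b : ℝ | x ∈ evolvedLow f b t}, (b : EReal)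

/-- `w_*(x, t) = sup {b : x ∈ A(w, b, t)}`. -/
def wStar {I : Set ℝ} (f : C(I, ℝ) × C(I, ℝ)) (x t : ℝ) : EReal :=
  ⨆ b ∈ {b : ℝ | x ∈ evolvedHigh f b t}, (b : EReal)

/-- `u` is the constructed solution with initial value `f`: it is a solution with this initial
value, and it is given by the explicit formulas at all interior points of `I` (at the endpoints it
is then determined by continuity). -/
def IsConstructedSolution {I : Set ℝ} (f : C(I, ℝ) × C(I, ℝ))
    (u : C(SpaceTime I, ℝ) × C(SpaceTime I, ℝ)) : Prop :=
  IsSolution u ∧ HasInitialValue u f ∧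
    ∀ (x : I) (t : ℝ≥0), (x : ℝ) ∈ interior I →
      ((u.1 (x, t) : ℝ) : EReal) = vStar f x t ∧ ((u.2 (x, t) : ℝ) : EReal) = wStar f x t

end FreezingTransport

end

/-! The formulas for the two components make sense for every continuous initial condition, so no
limit of regular data is taken: the operator is given by the formulas on all data, and each property
is read off from them. In characteristic coordinates ξ = x - t, η = x + t, a level b is admissible
at (ξ, η) if ξ lies in {v ≤ b} and the mass of 1_{v ≤ b} - 1_{w ≥ b} over [ξ, y] is nonnegative for
all y in [ξ, η] (`PL`). `V` is the infimum of these levels. `W` is defined by the reflection that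
exchanges the components, so facts about `W` are mirror images of facts about `V`.

Contraction: if the data grow by at most c, the density at level b + c is at least the old one at
level b, so `V` grows by at most c, and only the data on [ξ, η] matter (`V_le_of_data_le`).

Continuity: if a small move of the window needed a much larger level, the masses of two levels would
almost agree, although v or w crosses the band between them on an interval of definite length
(`PL_stable`). The same stability yields W ≤ V (`PL_PH_le`).

Equations: V increases along its characteristic through b only where the mass reaches 0, and there a
particle of {w ≥ b} has also survived, so V ≤ b ≤ W (`exists_touching`). Hence V is transported
where W < V, and also above a base satisfying a suitable separation (`V_eq_of_base`), which is the
selection condition. Where V = W on a box, counting mass on a slightly shifted window shows that the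
common value is constant in time (`W_le_V_of_frozen`). At a wall, a level below V needs w ≥ b on
almost all of the adjacent piece, which makes W almost as large (`V_le_W_add_of_wall`).

Density on a compact interval comes from polynomials, with v - w approximated by a square. -/

noncomputable section

namespace FreezingTransport

open Filter Topology MeasureTheory Polynomial

/-! ### Profiles, the signed density and its mass -/

/-- An initial condition on a closed interval `I`, given by functions on the whole line of which
only the values on `I` matter. -/
structure Profile where
  I : Set ℝ
  v : ℝ → ℝ
  w : ℝ → ℝ
  ordConnected : I.OrdConnected
  isClosed : IsClosed I
  contV : ContinuousOn v I
  contW : ContinuousOn w I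
  le : ∀ x ∈ I, w x ≤ v x
  eqLow : ∀ a ∈ I, a ∈ lowerBounds I → v a = w a
  eqHigh : ∀ a ∈ I, a ∈ upperBounds I → v a = w a

namespace Profile

variable (P : Profile)

theorem neg_mem_lowerBounds {s : Set ℝ} {z : ℝ} :
    z ∈ lowerBounds {x : ℝ | -x ∈ s} ↔ -z ∈ upperBounds s := by
  constructor
  · intro h x hx
    have := h (a := -x) (by simpa using hx)
    linarith
  · intro h x hx
    have := h hx
    linarith

theorem neg_mem_upperBounds {s : Set ℝ} {z : ℝ} :
    z ∈ upperBounds {x : ℝ | -x ∈ s} ↔ -z ∈ lowerBounds s := by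
  constructor
  · intro h x hx
    have := h (a := -x) (by simpa using hx)
    linarith
  · intro h x hx
    have := h hx
    linarith

/-- The symmetry exchanging the two components. -/
def reflect : Profile where
  I := {x | -x ∈ P.I}
  v := fun x => -P.w (-x)
  w := fun x => -P.v (-x)
  ordConnected := by
    refine ⟨fun x hx y hy z hz => ?_⟩
    exact P.ordConnected.out hy hx ⟨by linarith [hz.2], by linarith [hz.1]⟩
  isClosed := P.isClosed.preimage continuous_neg
  contV := (P.contW.comp continuous_neg.continuousOn (fun _ h => h)).neg
  contW := (P.contV.comp continuous_neg.continuousOn (fun _ h => h)).neg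
  le := fun x hx => neg_le_neg (P.le _ hx)
  eqLow := fun a ha h => by
    rw [P.eqHigh _ ha (neg_mem_lowerBounds.1 h)]
  eqHigh := fun a ha h => by
    rw [P.eqLow _ ha (neg_mem_upperBounds.1 h)]

theorem reflect_reflect : P.reflect.reflect = P := by
  cases P; simp [reflect]

/-- The points strictly between the endpoints of the interval. -/
def Inner (x : ℝ) : Prop := x ∉ lowerBounds P.I ∧ x ∉ upperBounds P.I

variable {P}

theorem inner_reflect {x : ℝ} : P.reflect.Inner x ↔ P.Inner (-x) := by
  simp only [Inner, reflect, neg_mem_lowerBounds, neg_mem_upperBounds]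
  tauto

theorem lb_mono {x y : ℝ} (h : y ∈ lowerBounds P.I) (hxy : x ≤ y) : x ∈ lowerBounds P.I :=
  fun _ hz => hxy.trans (h hz)

theorem ub_mono {x y : ℝ} (h : x ∈ upperBounds P.I) (hxy : x ≤ y) : y ∈ upperBounds P.I :=
  fun _ hz => (h hz).trans hxy

theorem Inner.mem {x : ℝ} (h : P.Inner x) : x ∈ P.I := by
  obtain ⟨h1, h2⟩ := h
  simp only [lowerBounds, upperBounds, mem_ofPred_eq, not_forall, not_le] at h1 h2
  obtain ⟨a, ha, hax⟩ := h1
  obtain ⟨b, hb, hbx⟩ := h2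
  exact P.ordConnected.out ha hb ⟨hax.le, hbx.le⟩

theorem Inner.between {x y z : ℝ} (hx : P.Inner x) (hy : P.Inner y) (h1 : x ≤ z) (h2 : z ≤ y) :
    P.Inner z :=
  ⟨fun h => hx.1 (lb_mono h h1), fun h => hy.2 (ub_mono h h2)⟩

theorem inner_of_mem_of_mem {x y z : ℝ} (hx : x ∈ P.I) (hy : y ∈ P.I) (h1 : x < z) (h2 : z < y) :
    P.Inner z :=
  ⟨fun h => (h hx).not_gt h1, fun h => (h hy).not_gt h2⟩

theorem isClosed_lowerBounds (s : Set ℝ) : IsClosed (lowerBounds s) := by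
  have : lowerBounds s = ⋂ z ∈ s, Iic z := by ext; simp [lowerBounds]
  rw [this]
  exact isClosed_biInter fun _ _ => isClosed_Iic

theorem isClosed_upperBounds (s : Set ℝ) : IsClosed (upperBounds s) := by
  have : upperBounds s = ⋂ z ∈ s, Ici z := by ext; simp [upperBounds]
  rw [this]
  exact isClosed_biInter fun _ _ => isClosed_Ici

theorem isOpen_inner : IsOpen {x | P.Inner x} :=
  (isClosed_lowerBounds P.I).isOpen_compl.inter (isClosed_upperBounds P.I).isOpen_compl

theorem exists_least {ξ x : ℝ} (hξ : ξ ∈ lowerBounds P.I) (hx : x ∉ lowerBounds P.I) :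
    ∃ a ∈ P.I, a ∈ lowerBounds P.I ∧ ξ ≤ a ∧ a < x := by
  have hne : P.I.Nonempty := by
    by_contra h
    rw [not_nonempty_iff_eq_empty] at h
    exact hx (by simp [h])
  have hm := P.isClosed.csInf_mem hne ⟨ξ, hξ⟩
  have hl : sInf P.I ∈ lowerBounds P.I := fun z hz => csInf_le ⟨ξ, hξ⟩ hz
  refine ⟨_, hm, hl, hξ hm, ?_⟩
  by_contra h
  exact hx (lb_mono hl (not_lt.1 h))

theorem exists_greatest {ξ x : ℝ} (hξ : ξ ∈ upperBounds P.I) (hx : x ∉ upperBounds P.I) :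
    ∃ a ∈ P.I, a ∈ upperBounds P.I ∧ a ≤ ξ ∧ x < a := by
  have hne : P.I.Nonempty := by
    by_contra h
    rw [not_nonempty_iff_eq_empty] at h
    exact hx (by simp [h])
  have hm := P.isClosed.csSup_mem hne ⟨ξ, hξ⟩
  have hl : sSup P.I ∈ upperBounds P.I := fun z hz => le_csSup ⟨ξ, hξ⟩ hz
  refine ⟨_, hm, hl, hξ hm, ?_⟩
  by_contra h
  exact hx (ub_mono hl (not_lt.1 h))

variable (P)

/-- `{v ≤ b}` together with the lower bounds of the interval. -/
def low (b : ℝ) : Set ℝ := {z | z ∈ P.I ∧ P.v z ≤ b} ∪ lowerBounds P.I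

/-- `{w ≥ b}` together with the upper bounds of the interval. -/
def high (b : ℝ) : Set ℝ := {z | z ∈ P.I ∧ b ≤ P.w z} ∪ upperBounds P.I

theorem isClosed_low (b : ℝ) : IsClosed (P.low b) :=
  (P.contV.preimage_isClosed_of_isClosed P.isClosed isClosed_Iic).union (isClosed_lowerBounds _)

theorem isClosed_high (b : ℝ) : IsClosed (P.high b) :=
  (P.contW.preimage_isClosed_of_isClosed P.isClosed isClosed_Ici).union (isClosed_upperBounds _)

open Classical in
/-- The signed density `1_{v ≤ b} - 1_{w ≥ b}`, continued by `1` to the left of the interval and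
by `-1` to the right. -/
def kern (b z : ℝ) : ℝ :=
  (if z ∈ lowerBounds P.I ∨ (z ∉ upperBounds P.I ∧ P.v z ≤ b) then 1 else 0)
    - (if z ∈ upperBounds P.I ∨ (z ∉ lowerBounds P.I ∧ b ≤ P.w z) then 1 else 0)

variable {P}

theorem abs_kern_le (b z : ℝ) : |P.kern b z| ≤ 1 := by
  unfold kern
  split_ifs <;> norm_num

theorem kern_of_lb {b z : ℝ} (h : z ∈ lowerBounds P.I) (h' : z ∉ upperBounds P.I) :
    P.kern b z = 1 := by
  simp [kern, h, h']

theorem kern_of_ub {b z : ℝ} (h : z ∈ upperBounds P.I) (h' : z ∉ lowerBounds P.I) :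
    P.kern b z = -1 := by
  simp [kern, h, h']

open Classical in
theorem kern_of_inner {b z : ℝ} (h : P.Inner z) :
    P.kern b z = (if P.v z ≤ b then 1 else 0) - (if b ≤ P.w z then 1 else 0) := by
  simp [kern, h.1, h.2]

theorem kern_mono_data {Q : Profile} (hI : Q.I = P.I) {b b' z : ℝ}
    (hv : P.Inner z → P.v z ≤ b → Q.v z ≤ b') (hw : P.Inner z → b' ≤ Q.w z → b ≤ P.w z) :
    P.kern b z ≤ Q.kern b' z := by
  unfold kern
  rw [hI]
  by_cases h1 : z ∈ lowerBounds P.I <;> by_cases h2 : z ∈ upperBounds P.I <;> simp only [h1, h2]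
  · simp
  · simp
  · simp
  · have hi : P.Inner z := ⟨h1, h2⟩
    have hv := hv hi
    have hw := hw hi
    simp only [not_false_eq_true, true_and, false_or]
    split_ifs <;> first | (exfalso; tauto) | norm_num

theorem kern_mono {b b' : ℝ} (h : b ≤ b') (z : ℝ) : P.kern b z ≤ P.kern b' z :=
  kern_mono_data rfl (fun _ h1 => h1.trans h) (fun _ h1 => h.trans h1)

open Classical in
theorem kern_reflect (b z : ℝ) : P.reflect.kern b z = -P.kern (-b) (-z) := by
  unfold kern
  have e1 : z ∈ lowerBounds P.reflect.I ↔ -z ∈ upperBounds P.I := neg_mem_lowerBounds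
  have e2 : z ∈ upperBounds P.reflect.I ↔ -z ∈ lowerBounds P.I := neg_mem_upperBounds
  have e3 : P.reflect.v z ≤ b ↔ -b ≤ P.w (-z) := by
    simp only [reflect]; constructor <;> intro <;> linarith
  have e4 : b ≤ P.reflect.w z ↔ P.v (-z) ≤ -b := by
    simp only [reflect]; constructor <;> intro <;> linarith
  rw [if_congr (or_congr e1 (and_congr (not_congr e2) e3)) rfl rfl,
    if_congr (or_congr e2 (and_congr (not_congr e1) e4)) rfl rfl]
  ring

theorem measurable_kern (b : ℝ) : Measurable (P.kern b) := by
  have key : ∀ Q : Profile, MeasurableSet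
      {z | z ∈ lowerBounds Q.I ∨ (z ∉ upperBounds Q.I ∧ Q.v z ≤ b)} := by
    intro Q
    have : {z | z ∈ lowerBounds Q.I ∨ (z ∉ upperBounds Q.I ∧ Q.v z ≤ b)}
        = lowerBounds Q.I ∪ (Q.low b \ upperBounds Q.I) := by
      ext z
      simp only [low, mem_ofPred_eq, mem_union, Set.mem_sdiff]
      by_cases h1 : z ∈ lowerBounds Q.I <;> by_cases h2 : z ∈ upperBounds Q.I <;> simp [h1, h2]
      exact fun _ => Inner.mem ⟨h1, h2⟩
    rw [this]
    exact (isClosed_lowerBounds _).measurableSet.union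
      ((Q.isClosed_low b).measurableSet.diff (isClosed_upperBounds _).measurableSet)
  have key' : MeasurableSet
      {z | z ∈ upperBounds P.I ∨ (z ∉ lowerBounds P.I ∧ b ≤ P.w z)} := by
    have : {z | z ∈ upperBounds P.I ∨ (z ∉ lowerBounds P.I ∧ b ≤ P.w z)}
        = upperBounds P.I ∪ (P.high b \ lowerBounds P.I) := by
      ext z
      simp only [high, mem_ofPred_eq, mem_union, Set.mem_sdiff]
      by_cases h1 : z ∈ lowerBounds P.I <;> by_cases h2 : z ∈ upperBounds P.I <;> simp [h1, h2]
      exact fun _ => Inner.mem ⟨h1, h2⟩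
    rw [this]
    exact (isClosed_upperBounds _).measurableSet.union
      ((P.isClosed_high b).measurableSet.diff (isClosed_lowerBounds _).measurableSet)
  exact (Measurable.ite (key P) measurable_const measurable_const).sub
    (Measurable.ite key' measurable_const measurable_const)

theorem intervalIntegrable_kern (b x y : ℝ) : IntervalIntegrable (P.kern b) volume x y :=
  (intervalIntegrable_const (c := (1 : ℝ))).mono_fun' (measurable_kern b).aestronglyMeasurable
    (ae_of_all _ fun z => abs_kern_le b z)

variable (P)

/-- The signed mass between two points. -/
def bal (b x y : ℝ) : ℝ := ∫ z in x..y, P.kern b z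

variable {P}

theorem bal_add (b x y z : ℝ) : P.bal b x y + P.bal b y z = P.bal b x z :=
  intervalIntegral.integral_add_adjacent_intervals (intervalIntegrable_kern _ _ _)
    (intervalIntegrable_kern _ _ _)

theorem bal_self (b x : ℝ) : P.bal b x x = 0 := intervalIntegral.integral_same

theorem abs_bal_le (b x y : ℝ) : |P.bal b x y| ≤ |y - x| := by
  have := intervalIntegral.norm_integral_le_of_norm_le_const (a := x) (b := y) (C := 1)
    (f := P.kern b) (fun z _ => abs_kern_le b z)
  simpa [bal] using this

theorem bal_le_of_kern_le {b x y c : ℝ} (hxy : x ≤ y) (h : ∀ z ∈ Ioo x y, P.kern b z ≤ c) :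
    P.bal b x y ≤ c * (y - x) := by
  have := intervalIntegral.integral_mono_on_of_le_Ioo hxy (intervalIntegrable_kern b x y)
    (intervalIntegrable_const (c := c)) h
  simpa [bal, mul_comm] using this

theorem le_bal_of_le_kern {b x y c : ℝ} (hxy : x ≤ y) (h : ∀ z ∈ Ioo x y, c ≤ P.kern b z) :
    c * (y - x) ≤ P.bal b x y := by
  have := intervalIntegral.integral_mono_on_of_le_Ioo hxy (intervalIntegrable_const (c := c))
    (intervalIntegrable_kern b x y) h
  simpa [bal, mul_comm] using this

theorem bal_mono_of_kern {Q : Profile} {b b' x y : ℝ} (hxy : x ≤ y)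
    (h : ∀ z ∈ Ioo x y, P.kern b z ≤ Q.kern b' z) : P.bal b x y ≤ Q.bal b' x y :=
  intervalIntegral.integral_mono_on_of_le_Ioo hxy (intervalIntegrable_kern b x y)
    (intervalIntegrable_kern b' x y) h

theorem bal_mono {b b' x y : ℝ} (h : b ≤ b') (hxy : x ≤ y) : P.bal b x y ≤ P.bal b' x y :=
  bal_mono_of_kern hxy fun z _ => kern_mono h z

/-- A jump of the density on an interval of length d shows up in the mass, because monotonicity in
the level prevents any cancellation elsewhere. This is what excludes crossings in `PL_stable`. -/
theorem bal_add_le_of_gap {b b' x y c d : ℝ} (h : b ≤ b') (hd : 0 ≤ d) (hxc : x ≤ c)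
    (hcy : c + d ≤ y) (hk : ∀ z ∈ Ioo c (c + d), P.kern b z + 1 ≤ P.kern b' z) :
    P.bal b x y + d ≤ P.bal b' x y := by
  have h1 := bal_mono (P := P) h hxc
  have h3 := bal_mono (P := P) h hcy
  have h2 : P.bal b c (c + d) + d ≤ P.bal b' c (c + d) := by
    have := intervalIntegral.integral_mono_on_of_le_Ioo (by linarith : c ≤ c + d)
      ((intervalIntegrable_kern b c (c + d)).add (intervalIntegrable_const (c := (1 : ℝ))))
      (intervalIntegrable_kern b' c (c + d)) hk
    rw [intervalIntegral.integral_add (intervalIntegrable_kern b c (c + d))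
      intervalIntegrable_const] at this
    simpa [bal] using this
  have e := bal_add (P := P) b x c (c + d)
  have e' := bal_add (P := P) b x (c + d) y
  have f := bal_add (P := P) b' x c (c + d)
  have f' := bal_add (P := P) b' x (c + d) y
  linarith

theorem bal_reflect (b x y : ℝ) : P.reflect.bal b x y = -P.bal (-b) (-y) (-x) := by
  simp only [bal, kern_reflect, intervalIntegral.integral_neg]
  rw [intervalIntegral.integral_comp_neg]

/-- In front of the left wall, a window filled with `{w > b}` has negative mass as soon as its
midpoint is to the right of the wall. -/
theorem bal_neg_of_wall {b ξ y : ℝ} (hξ : ξ ∈ lowerBounds P.I)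
    (hm : (ξ + y) / 2 ∉ lowerBounds P.I) (hw : ∀ z ∈ P.I, z ∈ Icc ξ y → b < P.w z) :
    P.bal b ξ y < 0 := by
  obtain ⟨a, haI, hal, hξa, ha⟩ := exists_least hξ hm
  -- The part left of the wall contributes at most a - ξ and the part right of it at most -(y - a);
  -- the sum is negative because the midpoint lies beyond a.
  have h1 := (abs_le.1 (abs_bal_le (P := P) b ξ a)).2
  rw [abs_of_nonneg (by linarith)] at h1
  have h2 : P.bal b a y ≤ (-1) * (y - a) := by
    refine bal_le_of_kern_le (by linarith) fun z hz => ?_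
    have hzl : z ∉ lowerBounds P.I := fun h => (h haI).not_gt hz.1
    by_cases hu : z ∈ upperBounds P.I
    · exact (kern_of_ub hu hzl).le
    · have hi : P.Inner z := ⟨hzl, hu⟩
      have h3 := hw z hi.mem ⟨hξa.trans hz.1.le, hz.2.le⟩
      have h4 := P.le z hi.mem
      rw [kern_of_inner hi, if_neg (by linarith), if_pos h3.le]
      norm_num
  have := bal_add (P := P) b ξ a y
  linarith

/-- A window on which `v < b` has nonnegative mass as long as its midpoint is to the left of the
right wall. -/
theorem bal_nonneg_of_low {b ξ y : ℝ} (hξy : ξ ≤ y)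
    (hm : (ξ + y) / 2 ∉ upperBounds P.I) (hv : ∀ z ∈ P.I, z ∈ Ioo ξ y → P.v z < b) :
    0 ≤ P.bal b ξ y := by
  have key : ∀ y', y' ≤ y → ξ ≤ y' → (∀ z < y', z ∉ upperBounds P.I) → y' - ξ ≤ P.bal b ξ y' := by
    intro y' hy' hξy' hu
    have : 1 * (y' - ξ) ≤ P.bal b ξ y' := by
      refine le_bal_of_le_kern hξy' fun z hz => ?_
      by_cases hzl : z ∈ lowerBounds P.I
      · exact (kern_of_lb hzl (hu z hz.2)).ge
      · have hi : P.Inner z := ⟨hzl, hu z hz.2⟩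
        have h3 := hv z hi.mem ⟨hz.1, hz.2.trans_le hy'⟩
        have h4 := P.le z hi.mem
        rw [kern_of_inner hi, if_pos (by linarith), if_neg (by linarith)]
        norm_num
    linarith
  -- Beyond the right wall a at most y - a is lost; the gain a - ξ before it suffices, since the
  -- midpoint is left of a.
  by_cases hy : y ∈ upperBounds P.I
  · obtain ⟨a, haI, hau, hay, ha⟩ := exists_greatest hy hm
    have h1 := key a hay (by linarith) (fun z hz h => (h haI).not_gt hz)
    have h2 := (abs_le.1 (abs_bal_le (P := P) b a y)).1
    rw [abs_of_nonneg (by linarith)] at h2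
    have := bal_add (P := P) b ξ a y
    linarith
  · have := key y le_rfl hξy (fun z hz h => hy (ub_mono h hz.le))
    linarith

/-- A continuous function which passes from `≤ β` to `≥ β'` stays in between on an interval whose
length is bounded below by the modulus of continuity. -/
theorem exists_crossing_interval_of_le {u : ℝ → ℝ} {p q β β' d : ℝ} (hpq : p ≤ q)
    (hu : ContinuousOn u (Icc p q)) (hp : u p ≤ β) (hq : β' ≤ u q)
    (hmod : ∀ z ∈ Icc p q, ∀ z' ∈ Icc p q, |z - z'| ≤ d → |u z - u z'| < β' - β) :
    ∃ c, p ≤ c ∧ c + d ≤ q ∧ ∀ z ∈ Ioo c (c + d), β < u z ∧ u z < β' := by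
  have hA : IsCompact {z ∈ Icc p q | u z ≤ β} :=
    isCompact_Icc.of_isClosed_subset
      (hu.preimage_isClosed_of_isClosed isClosed_Icc isClosed_Iic) fun _ h => h.1
  -- c is the last point with u ≤ β, and e below is the first point after it with u ≥ β'; the
  -- modulus forces e - c > d.
  obtain ⟨c, ⟨hcI, hc⟩, hcmax⟩ := hA.exists_isGreatest ⟨p, ⟨⟨le_rfl, hpq⟩, hp⟩⟩
  have hB : IsCompact {z ∈ Icc c q | β' ≤ u z} :=
    isCompact_Icc.of_isClosed_subset
      ((hu.mono (Icc_subset_Icc_left hcI.1)).preimage_isClosed_of_isClosed isClosed_Icc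
        isClosed_Ici)
        fun _ h => h.1
  obtain ⟨e, ⟨heI, he⟩, hemin⟩ := hB.exists_isLeast ⟨q, ⟨⟨hcI.2, le_rfl⟩, hq⟩⟩
  have hd : c + d < e := by
    by_contra hcon
    have := hmod e ⟨hcI.1.trans heI.1, heI.2⟩ c hcI
      (by rw [abs_of_nonneg (by linarith [heI.1])]; linarith)
    linarith [(abs_lt.1 this).2]
  refine ⟨c, hcI.1, by linarith [heI.2], fun z hz => ⟨?_, ?_⟩⟩
  · by_contra hcon
    have := hcmax (⟨⟨hcI.1.trans hz.1.le, by linarith [hz.2, heI.2]⟩, not_lt.1 hcon⟩ :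
      z ∈ {z ∈ Icc p q | u z ≤ β})
    linarith [hz.1]
  · by_contra hcon
    have := hemin (⟨⟨hz.1.le, by linarith [hz.2, heI.2]⟩, not_lt.1 hcon⟩ :
      z ∈ {z ∈ Icc c q | β' ≤ u z})
    linarith [hz.2]

theorem exists_crossing_interval {u : ℝ → ℝ} {p q β β' d : ℝ}
    (hu : ContinuousOn u (uIcc p q)) (hp : u p ≤ β) (hq : β' ≤ u q)
    (hmod : ∀ z ∈ uIcc p q, ∀ z' ∈ uIcc p q, |z - z'| ≤ d → |u z - u z'| < β' - β) :
    ∃ c, min p q ≤ c ∧ c + d ≤ max p q ∧ ∀ z ∈ Ioo c (c + d), β < u z ∧ u z < β' := by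
  rcases le_total p q with h | h
  · rw [uIcc_of_le h] at hu hmod
    rw [min_eq_left h, max_eq_right h]
    exact exists_crossing_interval_of_le h hu hp hq hmod
  · rw [uIcc_of_ge h] at hu hmod
    rw [min_eq_right h, max_eq_left h]
    obtain ⟨c, h1, h2, h3⟩ := exists_crossing_interval_of_le (u := fun z => -u z) (β := -β')
      (β' := -β) (d := d) h hu.neg (by linarith) (by linarith)
      (fun z hz z' hz' hzz => by
        have := hmod z hz z' hz' hzz
        rw [show -u z - -u z' = -(u z - u z') by ring, abs_neg]
        linarith)
    exact ⟨c, h1, h2, fun z hz => ⟨by linarith [(h3 z hz).2], by linarith [(h3 z hz).1]⟩⟩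

end Profile

/-! ### Survival of particles and the formulas in characteristic coordinates -/

namespace Profile

variable (P : Profile)

/-- In characteristic coordinates `ξ = x - t`, `η = x + t`: the particle of `low b` which starts
at `ξ` survives until it meets the line of `η`. -/
def PL (b ξ η : ℝ) : Prop := ξ ∈ P.low b ∧ ∀ y ∈ Icc ξ η, 0 ≤ P.bal b ξ y

/-- The particle of `high b` which starts at `η` survives until it meets the line of `ξ`. -/
def PH (b ξ η : ℝ) : Prop := η ∈ P.high b ∧ ∀ y ∈ Icc ξ η, P.bal b y η ≤ 0

variable {P}

theorem mem_low_reflect {b z : ℝ} : z ∈ P.reflect.low b ↔ -z ∈ P.high (-b) := by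
  have e1 : z ∈ lowerBounds P.reflect.I ↔ -z ∈ upperBounds P.I := neg_mem_lowerBounds
  have e3 : P.reflect.v z ≤ b ↔ -b ≤ P.w (-z) := by
    simp only [reflect]; constructor <;> intro <;> linarith
  exact or_congr (and_congr Iff.rfl e3) e1

theorem PL_reflect {b ξ η : ℝ} : P.reflect.PL b ξ η ↔ P.PH (-b) (-η) (-ξ) := by
  refine and_congr mem_low_reflect ⟨fun h y hy => ?_, fun h y hy => ?_⟩
  · have := h (-y) ⟨by linarith [hy.2], by linarith [hy.1]⟩
    rw [bal_reflect, neg_neg] at this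
    linarith
  · have := h (-y) ⟨by linarith [hy.2], by linarith [hy.1]⟩
    rw [bal_reflect]
    linarith

theorem PL_anti_right {b ξ η η' : ℝ} (h : P.PL b ξ η') (hη : η ≤ η') : P.PL b ξ η :=
  ⟨h.1, fun y hy => h.2 y ⟨hy.1, hy.2.trans hη⟩⟩

/-- The crossing interval lies between two points of I, so it avoids the walls and the density on it
is determined by v and w. -/
theorem exists_crossing_in_window {u : ℝ → ℝ} (hu : ContinuousOn u P.I) {l r p q β β' ε d : ℝ}
    (hp : p ∈ P.I) (hq : q ∈ P.I) (hpw : p ∈ Icc l r) (hqw : q ∈ Icc l r) (hε : ε ≤ β' - β)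
    (hmod : ∀ z ∈ P.I, ∀ z' ∈ P.I, z ∈ Icc l r → z' ∈ Icc l r → |z - z'| ≤ d → |u z - u z'| < ε)
    (hup : u p ≤ β) (huq : β' ≤ u q) :
    ∃ c, l ≤ c ∧ c + d ≤ r ∧ ∀ z ∈ Ioo c (c + d), P.Inner z ∧ β < u z ∧ u z < β' := by
  have hsub : uIcc p q ⊆ P.I := P.ordConnected.uIcc_subset hp hq
  have hsub' : uIcc p q ⊆ Icc l r := ordConnected_Icc.uIcc_subset hpw hqw
  obtain ⟨c, h1, h2, h3⟩ := exists_crossing_interval (hu.mono hsub) hup huq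
    (fun z hz z' hz' h => (hmod z (hsub hz) z' (hsub hz') (hsub' hz) (hsub' hz') h).trans_le hε)
  refine ⟨c, (le_min hpw.1 hqw.1).trans h1, h2.trans (max_le hpw.2 hqw.2),
    fun z hz => ⟨?_, h3 z hz⟩⟩
  have ha : min p q ∈ P.I := by rcases min_choice p q with h | h <;> rwa [h]
  have hb : max p q ∈ P.I := by rcases max_choice p q with h | h <;> rwa [h]
  exact inner_of_mem_of_mem ha hb (h1.trans_lt hz.1) (hz.2.trans_le h2)

/-- Survival is stable under small perturbations of the window, at the price of a small increase
of the level. -/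
theorem PL_stable {b b' ξ η ξ' η' s ε : ℝ} (hs : 0 < s) (hε : 0 < ε) (hb : b + 4 * ε ≤ b')
    (hmodv : ∀ z ∈ P.I, ∀ z' ∈ P.I, z ∈ Icc (ξ - s) (η + s) → z' ∈ Icc (ξ - s) (η + s) →
      |z - z'| ≤ 2 * s → |P.v z - P.v z'| < ε)
    (hmodw : ∀ z ∈ P.I, ∀ z' ∈ P.I, z ∈ Icc (ξ - s) (η + s) → z' ∈ Icc (ξ - s) (η + s) →
      |z - z'| ≤ 2 * s → |P.w z - P.w z'| < ε)
    (h : P.PL b ξ η) (hξη : ξ ≤ η) (hle : ξ' ≤ η') (hξ : |ξ' - ξ| ≤ s) (hη : η' ≤ η + s)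
    (hx1 : (ξ + η) / 2 ∉ lowerBounds P.I) (hx2 : (ξ' + η') / 2 ∉ upperBounds P.I) :
    P.PL b' ξ' η' := by
  have hξ1 := (abs_le.1 hξ).1
  have hξ2 := (abs_le.1 hξ).2
  have hbb : b ≤ b' := by linarith
  have hξ'u : ξ' ∉ upperBounds P.I := fun hu => hx2 (ub_mono hu (by linarith))
  refine ⟨?_, fun y hy => ?_⟩
  · by_contra hcon
    have hl : ξ' ∉ lowerBounds P.I := fun hl => hcon (Or.inr hl)
    have hi : P.Inner ξ' := ⟨hl, hξ'u⟩
    have hv : b' < P.v ξ' := by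
      by_contra hv
      exact hcon (Or.inl ⟨hi.mem, not_lt.1 hv⟩)
    have hw' : ξ' ∈ Icc (ξ - s) (η + s) := ⟨by linarith, by linarith⟩
    rcases h.1 with h1 | h1
    · have := hmodv ξ' hi.mem ξ h1.1 hw' ⟨by linarith, by linarith⟩ (by linarith)
      linarith [(abs_lt.1 this).2, h1.2]
    -- The wall a lies in [ξ, ξ'), within s of ξ'. Since v = w at a, w > b on [a, a + 2s] (up to η),
    -- and the mass of level b started at ξ would become negative.
    · obtain ⟨a, haI, hal, hξa, ha⟩ := exists_least h1 hl
      have haw : a ∈ Icc (ξ - s) (η + s) := ⟨by linarith, by linarith⟩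
      have h2 := hmodv ξ' hi.mem a haI hw' haw (by rw [abs_of_nonneg (by linarith)]; linarith)
      have h3 := P.eqLow a haI hal
      have h4 := (abs_lt.1 h2).2
      have hy : ξ ≤ min η (a + 2 * s) := le_min hξη (by linarith)
      have := bal_neg_of_wall (b := b) (y := min η (a + 2 * s)) h1 (by
        rcases min_choice η (a + 2 * s) with e | e <;> rw [e]
        · exact hx1
        · intro hlb
          linarith [hlb haI]) (by
        intro z hz hzy
        have hz1 : a ≤ z := hal hz
        have hz2 : z ≤ η := hzy.2.trans (min_le_left _ _)
        have hz3 : z ≤ a + 2 * s := hzy.2.trans (min_le_right _ _)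
        have := hmodw z hz a haI ⟨by linarith [hzy.1], by linarith⟩ haw
          (by rw [abs_of_nonneg (by linarith)]; linarith)
        linarith [(abs_lt.1 this).1])
      linarith [h.2 _ ⟨hy, min_le_left _ _⟩]
  · by_contra hneg
    rw [not_le] at hneg
    have hxy : (ξ' + y) / 2 ∉ upperBounds P.I := fun hu => hx2 (ub_mono hu (by linarith [hy.2]))
    have hleft : ∀ z ∈ P.I, z ∈ Ioo ξ' y → z < ξ → P.v z < b' := by
      intro z hz hzy hzξ
      rcases h.1 with h1 | h1
      · have := hmodv z hz ξ h1.1 ⟨by linarith [hzy.1], by linarith⟩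
          ⟨by linarith, by linarith⟩ (by rw [abs_of_nonpos (by linarith)]; linarith [hzy.1])
        linarith [h1.2, (abs_lt.1 this).2]
      · exact absurd (h1 hz) (not_le.2 hzξ)
    have hξy : ξ < y := by
      by_contra hcon
      have := bal_nonneg_of_low (P := P) (b := b') hy.1 hxy fun z hz hzy =>
        hleft z hz hzy (by linarith [hzy.2])
      linarith
    have hys : y ≤ η + s := hy.2.trans hη
    -- Moving an endpoint by at most s costs at most s, so the masses of b and b' over [ξ, y] differ
    -- by less than 2s.
    have hupper : P.bal b' ξ y < s := by
      have h1 := bal_add (P := P) b' ξ ξ' y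
      have h2 := (abs_le.1 ((abs_bal_le (P := P) b' ξ ξ').trans hξ)).2
      linarith
    have hlower : -s ≤ P.bal b ξ y := by
      rcases le_total y η with h1 | h1
      · linarith [h.2 y ⟨hξy.le, h1⟩]
      · have h2 := (abs_le.1 (abs_bal_le (P := P) b η y)).1
        rw [abs_of_nonneg (by linarith)] at h2
        linarith [h.2 η ⟨hξη, le_rfl⟩, bal_add (P := P) b ξ η y]
    have hwin : Icc ξ y ⊆ Icc (ξ - s) (η + s) := Icc_subset_Icc (by linarith) hys
    -- Hence the density cannot jump by 1 on an interval of length 2s. It follows in `hnv` and `hnw`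
    -- that neither v nor w has values on both sides of a band of height ε inside [b, b'].
    have hgap : ∀ c, ξ ≤ c → c + 2 * s ≤ y →
        ¬ ∀ z ∈ Ioo c (c + 2 * s), P.kern b z + 1 ≤ P.kern b' z := fun c h1 h2 h3 => by
      linarith [bal_add_le_of_gap hbb (by linarith) h1 h2 h3]
    have hnv : ∀ p ∈ P.I, ∀ q ∈ P.I, p ∈ Icc ξ y → q ∈ Icc ξ y → ∀ β β', b ≤ β → β' ≤ b' →
        ε ≤ β' - β → P.v p ≤ β → P.v q < β' := by
      intro p hp q hq hpy hqy β β' hβ hβ' hεβ hvp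
      by_contra hvq
      obtain ⟨c, h1, h2, h3⟩ := exists_crossing_in_window P.contV hp hq hpy hqy hεβ
        (fun z hz z' hz' hzw hzw' => hmodv z hz z' hz' (hwin hzw) (hwin hzw')) hvp (not_lt.1 hvq)
      refine hgap c h1 h2 fun z hz => ?_
      obtain ⟨hi, h4, h5⟩ := h3 z hz
      rw [kern_of_inner hi, kern_of_inner hi, if_neg (by linarith),
        if_pos (by linarith : P.v z ≤ b')]
      split_ifs <;> linarith
    have hnw : ∀ p ∈ P.I, ∀ q ∈ P.I, p ∈ Icc ξ y → q ∈ Icc ξ y → ∀ β β', b ≤ β → β' ≤ b' →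
        ε ≤ β' - β → P.w p ≤ β → P.w q < β' := by
      intro p hp q hq hpy hqy β β' hβ hβ' hεβ hvp
      by_contra hvq
      obtain ⟨c, h1, h2, h3⟩ := exists_crossing_in_window P.contW hp hq hpy hqy hεβ
        (fun z hz z' hz' hzw hzw' => hmodw z hz z' hz' (hwin hzw) (hwin hzw')) hvp (not_lt.1 hvq)
      refine hgap c h1 h2 fun z hz => ?_
      obtain ⟨hi, h4, h5⟩ := h3 z hz
      rw [kern_of_inner hi, kern_of_inner hi, if_pos (by linarith : b ≤ P.w z),
        if_neg (by linarith : ¬ b' ≤ P.w z)]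
      split_ifs <;> linarith
    obtain ⟨q, hqI, hqy, hvq⟩ : ∃ q ∈ P.I, q ∈ Icc ξ y ∧ b' ≤ P.v q := by
      by_contra! hcon
      have := bal_nonneg_of_low (P := P) (b := b') hy.1 hxy fun z hz hzy => by
        rcases lt_or_ge z ξ with h1 | h1
        · exact hleft z hz hzy h1
        · exact hcon z hz ⟨h1, hzy.2.le⟩
      linarith
    -- If v ξ ≤ b, the point q with v q ≥ b' would give such a crossing; so ξ is at or behind the
    -- left wall.
    have hξl : ξ ∈ lowerBounds P.I := by
      rcases h.1 with h1 | h1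
      · exact absurd (hnv ξ h1.1 q hqI ⟨le_rfl, hξy.le⟩ hqy b b' le_rfl le_rfl (by linarith) h1.2)
          (not_lt.2 hvq)
      · exact h1
    obtain ⟨a, haI, hal, hξa, ha⟩ := exists_least hξl hx1
    have hay : a ∈ Icc ξ y := ⟨hξa, (hal hqI).trans hqy.2⟩
    by_cases hw : ∀ z ∈ P.I, z ∈ Icc ξ y → b + ε < P.w z
    · have hys2 : 2 * a < ξ + y + s := by
        rcases le_or_gt ξ' a with h1 | h1
        · have h2 : 1 * (a - ξ') ≤ P.bal b' ξ' a := le_bal_of_le_kern h1 fun z hz =>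
            (kern_of_lb (lb_mono hal hz.2.le) (fun h => (h haI).not_gt hz.2)).ge
          have h3 := (abs_le.1 (abs_bal_le (P := P) b' a y)).1
          rw [abs_of_nonneg (by linarith [hay.2])] at h3
          linarith [bal_add (P := P) b' ξ' a y]
        · linarith [hy.1]
      have hy1 : ξ ≤ min η (y + s) := le_min hξη (by linarith)
      have := bal_neg_of_wall (b := b) (y := min η (y + s)) hξl (by
        rcases min_choice η (y + s) with e | e <;> rw [e]
        · exact hx1
        · intro hlb
          linarith [hlb haI]) (by
        intro z hz hzy
        have hz2 : z ≤ η := hzy.2.trans (min_le_left _ _)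
        have hz3 : z ≤ y + s := hzy.2.trans (min_le_right _ _)
        rcases le_or_gt z y with h1 | h1
        · linarith [hw z hz ⟨hzy.1, h1⟩]
        · have hyI : y ∈ P.I := P.ordConnected.out haI hz ⟨hay.2, h1.le⟩
          have := hmodw z hz y hyI ⟨by linarith [hzy.1], by linarith⟩ ⟨by linarith, hys⟩
            (by rw [abs_of_nonneg (by linarith)]; linarith)
          linarith [(abs_lt.1 this).1, hw y hyI ⟨hξy.le, le_rfl⟩])
      linarith [h.2 _ ⟨hy1, min_le_left _ _⟩]
    -- Now w ≤ b + ε somewhere, so w a < b + 2ε. As v a = w a, the values of v at a and q lie on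
    -- both sides of the band from b + 2ε to b'.
    · push Not at hw
      obtain ⟨p, hpI, hpy, hwp⟩ := hw
      have hva := P.eqLow a haI hal
      have h1 := hnw p hpI a haI hpy hay (b + ε) (b + 2 * ε) (by linarith) (by linarith)
        (by linarith) hwp
      have h2 := hnv a haI q hqI hay hqy (b + 2 * ε) b' (by linarith) le_rfl (by linarith)
        (by linarith)
      linarith

/-- The first component at the point with characteristic coordinates `ξ`, `η`. -/
def V (P : Profile) (ξ η : ℝ) : ℝ := sInf {b | P.PL b ξ η}

/-- The second component at the point with characteristic coordinates `ξ`, `η`. -/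
def W (P : Profile) (ξ η : ℝ) : ℝ := -P.reflect.V (-η) (-ξ)

theorem V_reflect (ξ η : ℝ) : P.reflect.V ξ η = -P.W (-η) (-ξ) := by simp [W]

theorem W_reflect (ξ η : ℝ) : P.reflect.W ξ η = -P.V (-η) (-ξ) := by simp [W, reflect_reflect]

theorem exists_bounds (ξ η : ℝ) : ∃ m M : ℝ, ∀ z ∈ P.I, z ∈ Icc ξ η → m < P.w z ∧ P.v z < M := by
  have hK : IsCompact (P.I ∩ Icc ξ η) := isCompact_Icc.inter_left P.isClosed
  obtain ⟨M, hM⟩ := hK.bddAbove_image (P.contV.mono inter_subset_left)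
  obtain ⟨m, hm⟩ := hK.bddBelow_image (P.contW.mono inter_subset_left)
  refine ⟨m - 1, M + 1, fun z hz hzI => ⟨?_, ?_⟩⟩
  · linarith [hm (mem_image_of_mem _ ⟨hz, hzI⟩)]
  · linarith [hM (mem_image_of_mem _ ⟨hz, hzI⟩)]

theorem exists_PL {ξ η : ℝ} (hξη : ξ ≤ η) (hx : P.Inner ((ξ + η) / 2)) : ∃ b, P.PL b ξ η := by
  obtain ⟨m, M, h⟩ := exists_bounds (P := P) ξ η
  refine ⟨M, ?_, fun y hy => bal_nonneg_of_low hy.1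
    (fun hu => hx.2 (ub_mono hu (by linarith [hy.2])))
    fun z hz hzy => (h z hz ⟨hzy.1.le, hzy.2.le.trans hy.2⟩).2⟩
  by_cases hl : ξ ∈ lowerBounds P.I
  · exact Or.inr hl
  · have hi : P.Inner ξ := ⟨hl, fun hu => hx.2 (ub_mono hu (by linarith))⟩
    exact Or.inl ⟨hi.mem, (h ξ hi.mem ⟨le_rfl, hξη⟩).2.le⟩

theorem bddBelow_PL {ξ η : ℝ} (hξη : ξ ≤ η) (hx : P.Inner ((ξ + η) / 2)) :
    BddBelow {b | P.PL b ξ η} := by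
  obtain ⟨m, M, h⟩ := exists_bounds (P := P) ξ η
  refine ⟨m, fun b hb => ?_⟩
  by_contra hcon
  rw [not_le] at hcon
  rcases hb.1 with h1 | h1
  · linarith [h1.2, P.le ξ h1.1, (h ξ h1.1 ⟨le_rfl, hξη⟩).1]
  · have := bal_neg_of_wall (b := b) h1 hx.1 fun z hz hzy => hcon.trans (h z hz hzy).1
    linarith [hb.2 η ⟨hξη, le_rfl⟩]

theorem PL_mono {b b' ξ η : ℝ} (h : P.PL b ξ η) (hb : b ≤ b') : P.PL b' ξ η :=
  ⟨h.1.imp (fun h => ⟨h.1, h.2.trans hb⟩) id, fun y hy => (h.2 y hy).trans (bal_mono hb hy.1)⟩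

theorem PL_of_V_lt {b ξ η : ℝ} (hξη : ξ ≤ η) (hx : P.Inner ((ξ + η) / 2)) (h : P.V ξ η < b) :
    P.PL b ξ η := by
  obtain ⟨b', h1, h2⟩ := exists_lt_of_csInf_lt (exists_PL hξη hx) h
  exact PL_mono h1 h2.le

theorem V_le_of_PL {b ξ η : ℝ} (hξη : ξ ≤ η) (hx : P.Inner ((ξ + η) / 2)) (h : P.PL b ξ η) :
    P.V ξ η ≤ b :=
  csInf_le (bddBelow_PL hξη hx) h

theorem inner_reflect_mid {ξ η : ℝ} (hx : P.Inner ((ξ + η) / 2)) :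
    P.reflect.Inner ((-η + -ξ) / 2) := by
  rw [inner_reflect]
  convert hx using 1
  ring

theorem PH_of_lt_W {b ξ η : ℝ} (hξη : ξ ≤ η) (hx : P.Inner ((ξ + η) / 2)) (h : b < P.W ξ η) :
    P.PH b ξ η := by
  have := PL_of_V_lt (P := P.reflect) (b := -b) (neg_le_neg hξη) (inner_reflect_mid hx)
    (by simp only [W] at h; linarith)
  simpa [PL_reflect] using this

theorem le_W_of_PH {b ξ η : ℝ} (hξη : ξ ≤ η) (hx : P.Inner ((ξ + η) / 2)) (h : P.PH b ξ η) :
    b ≤ P.W ξ η := by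
  have := V_le_of_PL (P := P.reflect) (b := -b) (neg_le_neg hξη) (inner_reflect_mid hx)
    (by simpa [PL_reflect] using h)
  simp only [W]
  linarith

theorem V_mono_right {ξ η η' : ℝ} (hξη : ξ ≤ η) (hη : η ≤ η') (hx : P.Inner ((ξ + η) / 2))
    (hx' : P.Inner ((ξ + η') / 2)) : P.V ξ η ≤ P.V ξ η' := by
  refine le_of_forall_gt_imp_ge_of_dense fun b hb => ?_
  exact V_le_of_PL hξη hx (PL_anti_right (PL_of_V_lt (hξη.trans hη) hx' hb) hη)

theorem W_mono_left {ξ ξ' η : ℝ} (hξη : ξ' ≤ η) (hξ : ξ ≤ ξ') (hx : P.Inner ((ξ + η) / 2))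
    (hx' : P.Inner ((ξ' + η) / 2)) : P.W ξ η ≤ P.W ξ' η := by
  have := V_mono_right (P := P.reflect) (neg_le_neg hξη) (neg_le_neg hξ) (inner_reflect_mid hx')
    (inner_reflect_mid hx)
  simp only [W]
  linarith

/-- A modulus of continuity on bounded windows. -/
theorem exists_modulus {u : ℝ → ℝ} (hu : ContinuousOn u P.I) (l r : ℝ) {ε : ℝ} (hε : 0 < ε) :
    ∃ d > 0, ∀ z ∈ P.I, ∀ z' ∈ P.I, z ∈ Icc l r → z' ∈ Icc l r → |z - z'| ≤ d →
      |u z - u z'| < ε := by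
  have hK : IsCompact (P.I ∩ Icc l r) := isCompact_Icc.inter_left P.isClosed
  have := hK.uniformContinuousOn_of_continuous (hu.mono inter_subset_left)
  obtain ⟨d, hd, h⟩ := Metric.uniformContinuousOn_iff.1 this ε hε
  exact ⟨d / 2, half_pos hd, fun z hz z' hz' hzl hzl' hd' =>
    h z ⟨hz, hzl⟩ z' ⟨hz', hzl'⟩ (hd'.trans_lt (half_lt_self hd))⟩

/-- Local uniform continuity of the first component. -/
theorem V_stable (l r : ℝ) {ε : ℝ} (hε : 0 < ε) :
    ∃ s > 0, ∀ ξ η ξ' η', l ≤ ξ → ξ ≤ η → η ≤ r → ξ' ≤ η' → |ξ' - ξ| ≤ s → η' ≤ η + s →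
      P.Inner ((ξ + η) / 2) → P.Inner ((ξ' + η') / 2) → P.V ξ' η' ≤ P.V ξ η + ε := by
  -- A quarter of ε, because `PL_stable` raises the level by four times the oscillation.
  obtain ⟨d, hd, h⟩ := exists_modulus P.contV (l - 1) (r + 1) (by linarith : 0 < ε / 4)
  obtain ⟨d', hd', h'⟩ := exists_modulus P.contW (l - 1) (r + 1) (by linarith : 0 < ε / 4)
  have hs1 : min 1 (min d d' / 2) ≤ 1 := min_le_left _ _
  have hs2 : min 1 (min d d' / 2) ≤ min d d' / 2 := min_le_right _ _
  have hs3 := min_le_left d d'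
  have hs4 := min_le_right d d'
  have hs0 : 0 < min 1 (min d d' / 2) := lt_min one_pos (half_pos (lt_min hd hd'))
  refine ⟨min 1 (min d d' / 2), hs0, fun ξ η ξ' η' hl hξη hr hle hξ hη hx hx' => ?_⟩
  rw [← sub_le_iff_le_add]
  refine le_of_forall_gt_imp_ge_of_dense fun b hb => ?_
  rw [sub_le_iff_le_add]
  have hsub : Icc (ξ - min 1 (min d d' / 2)) (η + min 1 (min d d' / 2)) ⊆ Icc (l - 1) (r + 1) :=
    Icc_subset_Icc (by linarith) (by linarith)
  exact V_le_of_PL hle hx' (PL_stable hs0 (by linarith : 0 < ε / 4) (by linarith)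
    (fun z hz z' hz' h1 h2 h3 => h z hz z' hz' (hsub h1) (hsub h2) (by linarith))
    (fun z hz z' hz' h1 h2 h3 => h' z hz z' hz' (hsub h1) (hsub h2) (by linarith))
    (PL_of_V_lt hξη hx hb) hξη hle hξ hη hx.1 hx'.2)

/-- If b < b', stability makes a level slightly below b' survive from ξ beyond η. But `PH` makes its
mass over [ξ, η] nonpositive, and just beyond η the density is -1: either w is still above that
level or the right wall has been passed. -/
theorem PL_PH_le {b b' ξ η : ℝ} (hξη : ξ ≤ η) (hx : P.Inner ((ξ + η) / 2)) (hL : P.PL b ξ η)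
    (hH : P.PH b' ξ η) : b' ≤ b := by
  by_contra! hcon
  -- Four ε pay for `PL_stable`; the fifth keeps w above b + 4ε next to η.
  set ε := (b' - b) / 5 with hε
  have hε0 : 0 < ε := by rw [hε]; linarith
  have hbε : b' = b + 5 * ε := by rw [hε]; ring
  obtain ⟨d, hd, h⟩ := exists_modulus P.contV (ξ - 1) (η + 1) hε0
  obtain ⟨d', hd', h'⟩ := exists_modulus P.contW (ξ - 1) (η + 1) hε0
  obtain ⟨e, he, h''⟩ := Metric.isOpen_iff.1 (isOpen_inner (P := P)) _ hx
  obtain ⟨s, hs0, hs1, hs2, hs3, hs4⟩ : ∃ s > 0, s ≤ 1 ∧ 2 * s ≤ d ∧ 2 * s ≤ d' ∧ s < e := by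
    refine ⟨min 1 (min (min d d') e / 2), by positivity, min_le_left _ _, ?_, ?_, ?_⟩
    all_goals
      have h1 := min_le_right 1 (min (min d d') e / 2)
      have h2 := min_le_left (min d d') e
      have h3 := min_le_right (min d d') e
      have h4 := min_le_left d d'
      have h5 := min_le_right d d'
      linarith
  have hsub : Icc (ξ - s) (η + s) ⊆ Icc (ξ - 1) (η + 1) :=
    Icc_subset_Icc (by linarith) (by linarith)
  have hx' : P.Inner ((ξ + (η + s)) / 2) := h'' (by
    rw [Metric.mem_ball, Real.dist_eq, abs_lt]; constructor <;> linarith)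
  have hL' := PL_stable (b' := b + 4 * ε) hs0 hε0 le_rfl
    (fun z hz z' hz' h1 h2 h3 => h z hz z' hz' (hsub h1) (hsub h2) (by linarith))
    (fun z hz z' hz' h1 h2 h3 => h' z hz z' hz' (hsub h1) (hsub h2) (by linarith))
    hL hξη (by linarith : ξ ≤ η + s) (by simpa using hs0.le) le_rfl hx.1 hx'.2
  have h1 := hL'.2 (η + s) ⟨by linarith, le_rfl⟩
  have h2 := hH.2 ξ ⟨le_rfl, hξη⟩
  have h3 := bal_mono (P := P) (by linarith : b + 4 * ε ≤ b') hξη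
  have h4 : P.bal (b + 4 * ε) η (η + s) ≤ (-1) * (η + s - η) := by
    refine bal_le_of_kern_le (by linarith) fun z hz => ?_
    have hzl : z ∉ lowerBounds P.I := fun hzl => hx.1 (lb_mono hzl (by linarith [hz.1]))
    by_cases hu : z ∈ upperBounds P.I
    · exact (kern_of_ub hu hzl).le
    · have hi : P.Inner z := ⟨hzl, hu⟩
      rcases hH.1 with h5 | h5
      · have h6 := h' z hi.mem η h5.1 ⟨by linarith [hz.1], by linarith [hz.2]⟩
          ⟨by linarith, by linarith⟩ (by rw [abs_of_nonneg (by linarith [hz.1])]; linarith [hz.2])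
        have h7 := (abs_lt.1 h6).1
        have h8 := P.le z hi.mem
        rw [kern_of_inner hi, if_neg (by linarith [h5.2]), if_pos (by linarith [h5.2])]
        norm_num
      · exact absurd (ub_mono h5 hz.1.le) hu
  linarith [bal_add (P := P) (b + 4 * ε) ξ η (η + s)]

theorem W_le_V {ξ η : ℝ} (hξη : ξ ≤ η) (hx : P.Inner ((ξ + η) / 2)) : P.W ξ η ≤ P.V ξ η := by
  by_contra! h
  obtain ⟨b, h1, h2⟩ := exists_between h
  obtain ⟨b', h3, h4⟩ := exists_between h2
  linarith [PL_PH_le hξη hx (PL_of_V_lt hξη hx h1) (PH_of_lt_W hξη hx h4)]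

/-! ### Transport where the components differ, rest where they agree -/

/-- When `V` increases along a characteristic through the level `b`, then a particle of `high b`
is met on the way. -/
theorem exists_touching {b ξ η η' : ℝ} (hξη : ξ ≤ η) (hη : η ≤ η')
    (hx : P.Inner ((ξ + η) / 2)) (hx' : P.Inner ((ξ + η') / 2)) (h : P.V ξ η < b)
    (h' : b < P.V ξ η') : ∃ y ∈ Icc η η', P.PL b ξ y ∧ P.PH b ξ y := by
  have hL := PL_of_V_lt hξη hx h
  have hnL : ¬ P.PL b ξ η' := fun hn => (V_le_of_PL (hξη.trans hη) hx' hn).not_gt h'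
  -- At the infimum y₀ of S the mass from ξ is 0, and before it nonnegative. Seen backwards from y₀
  -- it is therefore nonpositive, which is the mass condition of `PH`.
  set S := {y ∈ Icc ξ η' | P.bal b ξ y < 0}
  have hne : S.Nonempty := by
    by_contra hcon
    refine hnL ⟨hL.1, fun y hy => ?_⟩
    by_contra hneg
    exact hcon ⟨y, hy, not_le.1 hneg⟩
  have hbd : BddBelow S := ⟨ξ, fun y hy => hy.1.1⟩
  set y₀ := sInf S
  have hy0 : y₀ ≤ η' := (csInf_le hbd hne.some_mem).trans hne.some_mem.1.2
  have hyη : η ≤ y₀ := le_csInf hne fun y hy => by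
    by_contra hcon
    linarith [hL.2 y ⟨hy.1.1, (not_le.1 hcon).le⟩, hy.2]
  have hbelow : ∀ y, ξ ≤ y → y < y₀ → 0 ≤ P.bal b ξ y := fun y h1 h2 => by
    by_contra hcon
    exact (csInf_le hbd (⟨⟨h1, h2.le.trans hy0⟩, not_le.1 hcon⟩ : y ∈ S)).not_gt h2
  have hge : 0 ≤ P.bal b ξ y₀ := by
    rcases hyη.eq_or_lt with e | e
    · rw [← e]; exact hL.2 η ⟨hξη, le_rfl⟩
    · refine le_of_forall_pos_sub_le fun δ hδ => ?_
      have h1 := hbelow (max η (y₀ - δ)) (hξη.trans (le_max_left _ _)) (max_lt e (by linarith))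
      have h2 := (abs_le.1 (abs_bal_le (P := P) b (max η (y₀ - δ)) y₀)).1
      have h3 : max η (y₀ - δ) ≤ y₀ := max_le hyη (by linarith)
      rw [abs_of_nonneg (by linarith)] at h2
      linarith [bal_add (P := P) b ξ (max η (y₀ - δ)) y₀, le_max_right η (y₀ - δ)]
  have hnear : ∀ δ > 0, ∃ y ∈ S, y₀ ≤ y ∧ y < y₀ + δ := fun δ hδ => by
    obtain ⟨y, hy, h1⟩ := exists_lt_of_csInf_lt hne (by linarith : sInf S < y₀ + δ)
    exact ⟨y, hy, csInf_le hbd hy, h1⟩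
  have hle : P.bal b ξ y₀ ≤ 0 := by
    refine le_of_forall_pos_le_add fun δ hδ => ?_
    obtain ⟨y, hy, h1, h2⟩ := hnear δ hδ
    have h3 := (abs_le.1 (abs_bal_le (P := P) b y₀ y)).1
    rw [abs_of_nonneg (by linarith)] at h3
    linarith [bal_add (P := P) b ξ y₀ y, hy.2]
  have hlow : ∀ y ∈ Icc ξ y₀, 0 ≤ P.bal b ξ y := fun y hy => by
    rcases hy.2.eq_or_lt with e | e
    · rwa [e]
    · exact hbelow y hy.1 e
  refine ⟨y₀, ⟨hyη, hy0⟩, ⟨hL.1, hlow⟩, ?_, fun y hy => ?_⟩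
  -- The mass turns negative arbitrarily soon after y₀, so points of negative density, all of them
  -- in `high`, accumulate at y₀.
  · have : y₀ ∈ closure (P.high b) := by
      refine Metric.mem_closure_iff.2 fun δ hδ => ?_
      obtain ⟨y, hy, h1, h2⟩ := hnear δ hδ
      obtain ⟨z, hz, hk⟩ : ∃ z ∈ Ioo y₀ y, P.kern b z < 0 := by
        by_contra! hcon
        have := le_bal_of_le_kern h1 hcon
        linarith [bal_add (P := P) b ξ y₀ y, hy.2]
      refine ⟨z, ?_, by rw [Real.dist_eq, abs_lt]; constructor <;> linarith [hz.1, hz.2]⟩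
      by_contra hzh
      have hu : z ∉ upperBounds P.I := fun hu => hzh (Or.inr hu)
      by_cases hl : z ∈ lowerBounds P.I
      · rw [kern_of_lb hl hu] at hk; linarith
      · have hi : P.Inner z := ⟨hl, hu⟩
        rw [kern_of_inner hi, if_neg (fun hw => hzh (Or.inl ⟨hi.mem, hw⟩))] at hk
        split_ifs at hk <;> linarith
    rwa [(P.isClosed_high b).closure_eq] at this
  · linarith [bal_add (P := P) b ξ y y₀, hlow y hy]

/-- Along a characteristic, an increase of `V` through the level `b` happens at a point at which
`W ≥ b`. -/
theorem exists_le_W {b ξ η η' : ℝ} (hξη : ξ ≤ η) (hη : η ≤ η')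
    (hx : P.Inner ((ξ + η) / 2)) (hx' : P.Inner ((ξ + η') / 2)) (h : P.V ξ η < b)
    (h' : b < P.V ξ η') : ∃ y ∈ Icc η η', P.V ξ y ≤ b ∧ b ≤ P.W ξ y := by
  obtain ⟨y, hy, h1, h2⟩ := exists_touching hξη hη hx hx' h h'
  have hi : P.Inner ((ξ + y) / 2) := hx.between hx' (by linarith [hy.1]) (by linarith [hy.2])
  exact ⟨y, hy, V_le_of_PL (hξη.trans hy.1) hi h1, le_W_of_PH (hξη.trans hy.1) hi h2⟩

/-- An increase through a level b would produce a point with V ≤ b ≤ W. -/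
theorem V_eq_of_W_lt_V {ξ η η' : ℝ} (hξη : ξ ≤ η) (hη : η ≤ η') (hx : P.Inner ((ξ + η) / 2))
    (hx' : P.Inner ((ξ + η') / 2)) (h : ∀ y ∈ Icc η η', P.W ξ y < P.V ξ y) :
    P.V ξ η' = P.V ξ η := by
  refine le_antisymm ?_ (V_mono_right hξη hη hx hx')
  by_contra! hcon
  obtain ⟨b, h1, h2⟩ := exists_between hcon
  obtain ⟨y, hy, h3, h4⟩ := exists_le_W hξη hη hx hx' h1 h2
  linarith [h y hy]

/-- Transport over the triangle above a base at time `s` on which `w < v` off the diagonal. -/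
theorem V_eq_of_base {s ξ η : ℝ} (hs : 0 ≤ s) (hη : ξ + 2 * s ≤ η) (hx : P.Inner (ξ + s))
    (hx' : P.Inner ((ξ + η) / 2)) (hz : P.Inner (η - s))
    (h : ∀ z, ξ + s < z → z ≤ η - s → P.W (z - s) (z + s) < P.V ξ (ξ + 2 * s)) :
    P.V ξ η = P.V ξ (ξ + 2 * s) := by
  have hx0 : P.Inner ((ξ + (ξ + 2 * s)) / 2) := by convert hx using 1; ring
  refine le_antisymm ?_ (V_mono_right (by linarith) hη hx0 hx')
  by_contra! hcon
  obtain ⟨b, h1, h2⟩ := exists_between hcon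
  obtain ⟨y, hy, h3, h4⟩ := exists_le_W (by linarith) hη hx0 hx' h1 h2
  have hi : P.Inner ((ξ + y) / 2) := hx0.between hx' (by linarith [hy.1]) (by linarith [hy.2])
  rcases hy.1.eq_or_lt with e | e
  · rw [← e] at h4
    linarith [W_le_V (by linarith) hx0]
  · have hi' : P.Inner ((y - 2 * s + y) / 2) :=
      hx.between hz (by linarith [hy.1]) (by linarith [hy.2])
    -- Going back in time along its own characteristic, W does not decrease, so it is still at least
    -- b at the base point y - s; this contradicts `h`.
    have h5 := W_mono_left (ξ := ξ) (ξ' := y - 2 * s) (by linarith) (by linarith) hi hi'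
    have h6 := h (y - s) (by linarith) (by linarith [hy.2])
    rw [show y - s - s = y - 2 * s by ring, show y - s + s = y by ring] at h6
    linarith

/-- Strictness leaves a level b' with v ξ ≤ b' < b when ξ is inside I, so w ξ < b as well and the
second indicator vanishes. -/
theorem kern_eq_one {b ξ η : ℝ} (hξη : ξ ≤ η) (hx : P.Inner ((ξ + η) / 2)) (h : P.V ξ η < b) :
    P.kern b ξ = 1 := by
  obtain ⟨b', h1, h2⟩ := exists_between h
  have hu : ξ ∉ upperBounds P.I := fun hu => hx.2 (ub_mono hu (by linarith))
  by_cases hl : ξ ∈ lowerBounds P.I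
  · exact kern_of_lb hl hu
  · rcases (PL_of_V_lt hξη hx h1).1 with h3 | h3
    · have := P.le ξ h3.1
      rw [kern_of_inner ⟨hl, hu⟩, if_pos (by linarith [h3.2]), if_neg (by linarith [h3.2])]
      norm_num
    · exact absurd h3 hl

/-- Where `V = W`, the common value does not increase in time. -/
theorem W_le_V_of_frozen {x t s : ℝ} (ht : 0 ≤ t) (hs : 0 < s)
    (hin : ∀ z ∈ Icc (x - s) (x + s), P.Inner z)
    (hfr : ∀ z ∈ Icc (x - s) (x + s), ∀ τ ∈ Icc t (t + s),
      P.V (z - τ) (z + τ) = P.W (z - τ) (z + τ))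
    (hcont : ContinuousAt (fun z => P.V (z - t) (z + t)) x) :
    P.W (x - (t + s)) (x + (t + s)) ≤ P.V (x - t) (x + t) := by
  have hI : ∀ z ∈ Icc (x - s) (x + s), ∀ τ, P.Inner ((z - τ + (z + τ)) / 2) := fun z hz τ => by
    convert hin z hz using 1; ring
  by_contra! hcon
  obtain ⟨b, h1, h2⟩ := exists_between hcon
  obtain ⟨e, he, hball⟩ := Metric.eventually_nhds_iff.1 (hcont.eventually_lt_const h1)
  obtain ⟨δ, hδ, hδe, hδs⟩ : ∃ δ > 0, δ < e ∧ δ ≤ s :=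
    ⟨min (e / 2) s, by positivity, (min_le_left _ _).trans_lt (half_lt_self he), min_le_right _ _⟩
  have hp : P.V (x + δ - t) (x + δ + t) < b := hball (by
    rw [Real.dist_eq, abs_lt]; constructor <;> linarith)
  have hpm : x + δ ∈ Icc (x - s) (x + s) := ⟨by linarith, by linarith⟩
  have hxm : x ∈ Icc (x - s) (x + s) := ⟨by linarith, by linarith⟩
  have hL := PL_of_V_lt (by linarith) (hI _ hpm t) hp
  have hH := PH_of_lt_W (by linarith) (hI _ hxm (t + s)) h2
  -- The point with coordinates z and x + δ + t lies in the frozen box, so V = W there; this W is at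
  -- most its value at (x + δ, t), which is below b. Hence the density at z is 1.
  have hk : 1 * (x + δ - t - (x - (t + s))) ≤ P.bal b (x - (t + s)) (x + δ - t) := by
    refine le_bal_of_le_kern (by linarith) fun z hz => ?_
    have hm : (z + (x + δ + t)) / 2 ∈ Icc (x - s) (x + s) :=
      ⟨by linarith [hz.1], by linarith [hz.2]⟩
    have hi : P.Inner ((z + (x + δ + t)) / 2) := hin _ hm
    refine (kern_eq_one (by linarith [hz.2]) hi ?_).ge
    have h3 := hfr _ hm ((x + δ + t - z) / 2) ⟨by linarith [hz.2], by linarith [hz.1]⟩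
    rw [show (z + (x + δ + t)) / 2 - (x + δ + t - z) / 2 = z by ring,
      show (z + (x + δ + t)) / 2 + (x + δ + t - z) / 2 = x + δ + t by ring] at h3
    rw [h3]
    calc P.W z (x + δ + t) ≤ P.W (x + δ - t) (x + δ + t) :=
          W_mono_left (by linarith) hz.2.le hi (hI _ hpm t)
      _ ≤ P.V (x + δ - t) (x + δ + t) := W_le_V (by linarith) (hI _ hpm t)
      _ < b := hp
  -- The mass over [x - (t + s), x + (t + s)] is at least (s + δ) + 0 - (s - δ) = 2δ, but `PH`
  -- requires it to be nonpositive. The shift by δ provides the strictness.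
  have h3 := hL.2 (x + δ + t) ⟨by linarith, le_rfl⟩
  have h4 := hH.2 (x - (t + s)) ⟨le_rfl, by linarith⟩
  have h5 := (abs_le.1 (abs_bal_le (P := P) b (x + δ + t) (x + (t + s)))).1
  rw [abs_of_nonneg (by linarith)] at h5
  have h6 := bal_add (P := P) b (x - (t + s)) (x + δ - t) (x + (t + s))
  have h7 := bal_add (P := P) b (x + δ - t) (x + δ + t) (x + (t + s))
  linarith

end Profile

/-! ### The equations on rectangles, the wall estimate and comparison -/

namespace Profile

variable {P : Profile}

theorem inner_of_mem_Ioo {x₁ x₂ x : ℝ} (h : Ioo x₁ x₂ ⊆ P.I) (hx : x ∈ Ioo x₁ x₂) : P.Inner x := by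
  obtain ⟨y, hy1, hy2⟩ := exists_between hx.1
  obtain ⟨z, hz1, hz2⟩ := exists_between hx.2
  exact inner_of_mem_of_mem (h ⟨hy1, hy2.trans hx.2⟩) (h ⟨hx.1.trans hz1, hz2⟩) hy2 hz1

theorem Inner.mid {x : ℝ} (h : P.Inner x) (t : ℝ) : P.Inner ((x - t + (x + t)) / 2) := by
  convert h using 1; ring

/-- Local uniform continuity of the second component. -/
theorem W_stable (l r : ℝ) {ε : ℝ} (hε : 0 < ε) :
    ∃ s > 0, ∀ ξ η ξ' η', l ≤ ξ → ξ ≤ η → η ≤ r → ξ' ≤ η' → |η' - η| ≤ s → ξ ≤ ξ' + s →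
      P.Inner ((ξ + η) / 2) → P.Inner ((ξ' + η') / 2) → P.W ξ η ≤ P.W ξ' η' + ε := by
  obtain ⟨s, hs, h⟩ := V_stable (P := P.reflect) (-r) (-l) hε
  refine ⟨s, hs, fun ξ η ξ' η' hl hξη hr hle hη hξ hx hx' => ?_⟩
  have := h (-η) (-ξ) (-η') (-ξ') (by linarith) (by linarith) (by linarith) (by linarith)
    (by rw [show -η' - -η = -(η' - η) by ring, abs_neg]; exact hη) (by linarith)
    (inner_reflect_mid hx) (inner_reflect_mid hx')
  simp only [W]
  linarith

theorem W_eq_of_base {s ξ η : ℝ} (hs : 0 ≤ s) (hη : ξ + 2 * s ≤ η) (hx : P.Inner (η - s))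
    (hx' : P.Inner ((ξ + η) / 2)) (hz : P.Inner (ξ + s))
    (h : ∀ z, ξ + s ≤ z → z < η - s → P.W (η - 2 * s) η < P.V (z - s) (z + s)) :
    P.W ξ η = P.W (η - 2 * s) η := by
  have := V_eq_of_base (P := P.reflect) (s := s) (ξ := -η) (η := -ξ) hs (by linarith)
    (by rw [inner_reflect]; convert hx using 1; ring) (inner_reflect_mid hx')
    (by rw [inner_reflect]; convert hz using 1; ring) (fun z h1 h2 => by
      rw [V_reflect, W_reflect, neg_neg]
      have := h (-z) (by linarith) (by linarith)
      rw [show -(z + s) = -z - s by ring, show -(z - s) = -z + s by ring,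
        show -(-η + 2 * s) = η - 2 * s by ring]
      linarith)
  simp only [W, this]
  congr 2
  ring

theorem continuousAt_V {x t : ℝ} (ht : 0 ≤ t) (hx : P.Inner x) :
    ContinuousAt (fun z => P.V (z - t) (z + t)) x := by
  rw [Metric.continuousAt_iff]
  intro ε hε
  obtain ⟨s, hs, h⟩ := V_stable (P := P) (x - t - 1) (x + t + 1) (half_pos hε)
  obtain ⟨e, he, hball⟩ := Metric.isOpen_iff.1 (isOpen_inner (P := P)) _ hx
  refine ⟨min (min s e) 1, by positivity, fun z hz => ?_⟩
  have h1 := hz.trans_le ((min_le_left _ _).trans (min_le_left _ _))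
  have h2 := hz.trans_le ((min_le_left _ _).trans (min_le_right _ _))
  have h3 := hz.trans_le (min_le_right _ _)
  have hzi : P.Inner z := hball h2
  rw [Real.dist_eq, abs_lt] at *
  have h4 := h (x - t) (x + t) (z - t) (z + t) (by linarith) (by linarith) (by linarith)
    (by linarith) (by rw [abs_le]; constructor <;> linarith) (by linarith) (hx.mid t) (hzi.mid t)
  have h5 := h (z - t) (z + t) (x - t) (x + t) (by linarith) (by linarith) (by linarith)
    (by linarith) (by rw [abs_le]; constructor <;> linarith) (by linarith) (hzi.mid t) (hx.mid t)
  constructor <;> linarith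

/-- `W_le_V_of_frozen` and its mirror image give opposite inequalities, because V = W at both times.
-/
theorem V_eq_of_frozen_small {x t s : ℝ} (ht : 0 ≤ t) (hs : 0 < s)
    (hin : ∀ z ∈ Icc (x - s) (x + s), P.Inner z)
    (hfr : ∀ z ∈ Icc (x - s) (x + s), ∀ τ ∈ Icc t (t + s),
      P.V (z - τ) (z + τ) = P.W (z - τ) (z + τ)) :
    P.V (x - (t + s)) (x + (t + s)) = P.V (x - t) (x + t) := by
  have hxm : x ∈ Icc (x - s) (x + s) := ⟨by linarith, by linarith⟩
  have h1 := W_le_V_of_frozen ht hs hin hfr (continuousAt_V ht (hin x hxm))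
  have h2 := W_le_V_of_frozen (P := P.reflect) (x := -x) ht hs
    (fun z hz => inner_reflect.2 (hin (-z) ⟨by linarith [hz.2], by linarith [hz.1]⟩))
    (fun z hz τ hτ => by
      have := hfr (-z) ⟨by linarith [hz.2], by linarith [hz.1]⟩ τ hτ
      rw [V_reflect, W_reflect, show -(z + τ) = -z - τ by ring, show -(z - τ) = -z + τ by ring,
        this])
    (continuousAt_V ht (inner_reflect.2 (by rw [neg_neg]; exact hin x hxm)))
  rw [V_reflect, W_reflect, show -(-x + (t + s)) = x - (t + s) by ring,
    show -(-x - (t + s)) = x + (t + s) by ring, show -(-x + t) = x - t by ring,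
    show -(-x - t) = x + t by ring] at h2
  have h3 := hfr x hxm t ⟨le_rfl, by linarith⟩
  have h4 := hfr x hxm (t + s) ⟨by linarith, le_rfl⟩
  linarith

section Rectangle

variable {x₁ x₂ t₁ t₂ : ℝ}

theorem V_eq_of_frozen (hI : Ioo x₁ x₂ ⊆ P.I) (ht₁ : 0 ≤ t₁)
    (hfr : ∀ z ∈ Ioo x₁ x₂, ∀ τ ∈ Ioo t₁ t₂, P.V (z - τ) (z + τ) = P.W (z - τ) (z + τ))
    {x t t' : ℝ} (hx : x ∈ Ioo x₁ x₂) (ht : t ∈ Ioo t₁ t₂) (ht' : t' ∈ Ioo t₁ t₂) :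
    P.V (x - t') (x + t') = P.V (x - t) (x + t) := by
  -- A time step s uses the box of half-width s around x, which must fit into (x₁, x₂); long times
  -- are covered by iterating steps of length at most r.
  set r := min (x - x₁) (x₂ - x) / 2 with hr
  have hr0 : 0 < r := half_pos (lt_min (by linarith [hx.1]) (by linarith [hx.2]))
  have hr1 : 2 * r ≤ x - x₁ := by rw [hr]; linarith [min_le_left (x - x₁) (x₂ - x)]
  have hr2 : 2 * r ≤ x₂ - x := by rw [hr]; linarith [min_le_right (x - x₁) (x₂ - x)]
  have step : ∀ t ∈ Ioo t₁ t₂, ∀ s, 0 < s → s ≤ r → t + s < t₂ →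
      P.V (x - (t + s)) (x + (t + s)) = P.V (x - t) (x + t) := fun t ht s hs hsr hts => by
    have hsub : ∀ z ∈ Icc (x - s) (x + s), z ∈ Ioo x₁ x₂ := fun z hz =>
      ⟨by linarith [hz.1], by linarith [hz.2]⟩
    exact V_eq_of_frozen_small (by linarith [ht.1]) hs
      (fun z hz => inner_of_mem_Ioo hI (hsub z hz))
      (fun z hz τ hτ => hfr z (hsub z hz) τ ⟨by linarith [hτ.1, ht.1], by linarith [hτ.2]⟩)
  have key : ∀ n : ℕ, ∀ t ∈ Ioo t₁ t₂, ∀ t' ∈ Ioo t₁ t₂, t ≤ t' → t' - t ≤ n * r →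
      P.V (x - t') (x + t') = P.V (x - t) (x + t) := by
    intro n
    induction n with
    | zero =>
      intro t _ t' _ h1 h2
      simp only [Nat.cast_zero, zero_mul] at h2
      rw [show t' = t by linarith]
    | succ n ih =>
      intro t ht t' ht' h1 h2
      push_cast at h2
      rcases le_or_gt (t' - t) r with h3 | h3
      · rcases h1.eq_or_lt with e | e
        · rw [e]
        · have := step t ht (t' - t) (by linarith) h3 (by linarith [ht'.2])
          rwa [add_sub_cancel] at this
      · have h4 := step t ht r hr0 le_rfl (by linarith [ht'.2])
        rw [← h4]
        exact ih _ ⟨by linarith [ht.1], by linarith [ht'.2]⟩ t' ht' (by linarith) (by linarith)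
  have key' : ∀ t ∈ Ioo t₁ t₂, ∀ t' ∈ Ioo t₁ t₂, t ≤ t' →
      P.V (x - t') (x + t') = P.V (x - t) (x + t) := fun t ht t' ht' h => by
    obtain ⟨n, hn⟩ := exists_nat_ge ((t' - t) / r)
    exact key n t ht t' ht' h ((div_le_iff₀ hr0).1 hn)
  rcases le_total t t' with h | h
  · exact key' t ht t' ht' h
  · exact (key' t' ht' t ht h).symm

theorem V_eq_of_thawed (hI : Ioo x₁ x₂ ⊆ P.I) (ht₁ : 0 ≤ t₁)
    (hth : ∀ z ∈ Ioo x₁ x₂, ∀ τ ∈ Ioo t₁ t₂, P.W (z - τ) (z + τ) < P.V (z - τ) (z + τ))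
    {x t x' t' : ℝ} (hx : x ∈ Ioo x₁ x₂) (ht : t ∈ Ioo t₁ t₂) (hx' : x' ∈ Ioo x₁ x₂)
    (ht' : t' ∈ Ioo t₁ t₂) (h : x' - x = t' - t) :
    P.V (x' - t') (x' + t') = P.V (x - t) (x + t) := by
  have key : ∀ x t x' t', x ∈ Ioo x₁ x₂ → t ∈ Ioo t₁ t₂ → x' ∈ Ioo x₁ x₂ → t' ∈ Ioo t₁ t₂ →
      x' - x = t' - t → t ≤ t' → P.V (x' - t') (x' + t') = P.V (x - t) (x + t) := by
    intro x t x' t' hx ht hx' ht' h hle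
    have e : x' - t' = x - t := by linarith
    rw [e]
    refine V_eq_of_W_lt_V (by linarith [ht.1]) (by linarith) ((inner_of_mem_Ioo hI hx).mid t)
      (by rw [← e]; exact (inner_of_mem_Ioo hI hx').mid t') fun y hy => ?_
    have := hth ((x - t + y) / 2) ⟨by linarith [hy.1, hx.1], by linarith [hy.2, hx'.2]⟩
      ((y - (x - t)) / 2) ⟨by linarith [hy.1, ht.1], by linarith [hy.2, ht'.2]⟩
    rwa [show (x - t + y) / 2 - (y - (x - t)) / 2 = x - t by ring,
      show (x - t + y) / 2 + (y - (x - t)) / 2 = y by ring] at this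
  rcases le_total t t' with h1 | h1
  · exact key x t x' t' hx ht hx' ht' h h1
  · exact (key x' t' x t hx' ht' hx ht (by linarith) h1).symm

theorem W_eq_of_thawed (hI : Ioo x₁ x₂ ⊆ P.I) (ht₁ : 0 ≤ t₁)
    (hth : ∀ z ∈ Ioo x₁ x₂, ∀ τ ∈ Ioo t₁ t₂, P.W (z - τ) (z + τ) < P.V (z - τ) (z + τ))
    {x t x' t' : ℝ} (hx : x ∈ Ioo x₁ x₂) (ht : t ∈ Ioo t₁ t₂) (hx' : x' ∈ Ioo x₁ x₂)
    (ht' : t' ∈ Ioo t₁ t₂) (h : x' - x = -(t' - t)) :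
    P.W (x' - t') (x' + t') = P.W (x - t) (x + t) := by
  have hn : ∀ {z : ℝ}, z ∈ Ioo x₁ x₂ → -z ∈ Ioo (-x₂) (-x₁) := fun hz =>
    ⟨by linarith [hz.2], by linarith [hz.1]⟩
  have hn' : ∀ {z : ℝ}, z ∈ Ioo (-x₂) (-x₁) → -z ∈ Ioo x₁ x₂ := fun hz =>
    ⟨by linarith [hz.2], by linarith [hz.1]⟩
  have := V_eq_of_thawed (P := P.reflect) (x₁ := -x₂) (x₂ := -x₁) (fun z hz => hI (hn' hz)) ht₁
    (fun z hz τ hτ => by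
      have := hth (-z) (hn' hz) τ hτ
      rw [V_reflect, W_reflect, show -(z + τ) = -z - τ by ring, show -(z - τ) = -z + τ by ring]
      linarith)
    (hn hx) ht (hn hx') ht' (by linarith)
  rw [V_reflect, V_reflect, show -(-x' + t') = x' - t' by ring,
    show -(-x' - t') = x' + t' by ring, show -(-x + t) = x - t by ring,
    show -(-x - t) = x + t by ring] at this
  linarith

end Rectangle

/-- Near the left wall the two components are close to each other. -/
theorem V_le_W_add_of_wall {a : ℝ} (haI : a ∈ P.I) (hal : a ∈ lowerBounds P.I) {c : ℝ}
    (hcI : c ∈ P.I) (hac : a < c) (l r : ℝ) {ε : ℝ} (hε : 0 < ε) :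
    ∃ s > 0, ∀ ξ η, l ≤ ξ → ξ ≤ a → η ≤ r → P.Inner ((ξ + η) / 2) →
      ξ + η ≤ 2 * a + s → P.V ξ η ≤ P.W ξ η + ε := by
  obtain ⟨s₀, hs₀, hmod⟩ := exists_modulus P.contW l r hε
  obtain ⟨s, hs, hs1, hs2⟩ : ∃ s > 0, s ≤ s₀ ∧ a + s ≤ c :=
    ⟨min s₀ (c - a), lt_min hs₀ (by linarith), min_le_left _ _,
      by linarith [min_le_right s₀ (c - a)]⟩
  refine ⟨s / 2, half_pos hs, fun ξ η hl hξa hr hx hη => ?_⟩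
  have hax : a < (ξ + η) / 2 := by
    by_contra hcon
    exact hx.1 (lb_mono hal (not_lt.1 hcon))
  have hξη : ξ ≤ η := by linarith
  have haη : a ≤ η := by linarith
  refine le_of_forall_lt_imp_le_of_dense fun b hb => ?_
  -- A level b < V fails although ξ is behind the wall, so the mass becomes negative. It equals at
  -- least a - ξ at the wall, so little of [a, y] is free of {w ≥ b}. The modulus then gives w > b -
  -- ε on [a, η], and `PH` holds at level b - ε.
  obtain ⟨y, hy, hneg⟩ : ∃ y ∈ Icc ξ η, P.bal b ξ y < 0 := by
    by_contra! hcon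
    exact (V_le_of_PL hξη hx ⟨Or.inr (lb_mono hal hξa), hcon⟩).not_gt hb
  have hξbal : 1 * (a - ξ) ≤ P.bal b ξ a := le_bal_of_le_kern hξa fun z hz =>
    (kern_of_lb (lb_mono hal hz.2.le) (fun h => (h haI).not_gt hz.2)).ge
  have hay : a < y := by
    by_contra hcon
    have := le_bal_of_le_kern (P := P) (b := b) (c := 1) hy.1 fun z hz =>
      (kern_of_lb (lb_mono hal (hz.2.le.trans (not_lt.1 hcon)))
        (fun h => (h haI).not_gt (hz.2.trans_le (not_lt.1 hcon)))).ge
    linarith [hy.1]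
  have hy2 : 2 * a - ξ < y := by
    have := (abs_le.1 (abs_bal_le (P := P) b a y)).1
    rw [abs_of_nonneg (by linarith)] at this
    linarith [bal_add (P := P) b ξ a y]
  have hbal : P.bal b a y < -(a - ξ) := by linarith [bal_add (P := P) b ξ a y]
  have hw : ∀ z ∈ P.I, z ∈ Icc a η → b - ε < P.w z := by
    intro z hz hzw
    have hcI' : max z (a + s) ∈ P.I := by
      rcases max_choice z (a + s) with e | e <;> rw [e]
      · exact hz
      · exact P.ordConnected.out haI hcI ⟨by linarith, hs2⟩
    -- Nonnegative density on an interval of length y + ξ - 2a in [a, y] would keep the mass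
    -- nonnegative. (A, B) is at least that long, stays near z, and lies to the left of a point of
    -- I, so its points are interior.
    set A := max a (z - s)
    set B := min y (max z (a + s))
    have haA : a ≤ A := le_max_left _ _
    have hBy : B ≤ y := min_le_left _ _
    have hAB : y + ξ - 2 * a ≤ B - A := by
      have : A + (y + ξ - 2 * a) ≤ B := by
        rw [← max_add_add_right]
        refine max_le (le_min ?_ ?_) (le_min ?_ ?_)
        · linarith
        · linarith [le_max_right z (a + s), hy.2]
        · linarith [hzw.2]
        · linarith [le_max_left z (a + s), hy.2]
      linarith
    obtain ⟨z', hz', hk⟩ : ∃ z' ∈ Ioo A B, P.kern b z' < 0 := by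
      by_contra! hcon
      have h1 := le_bal_of_le_kern (by linarith) hcon
      have h2 := (abs_le.1 (abs_bal_le (P := P) b a A)).1
      have h3 := (abs_le.1 (abs_bal_le (P := P) b B y)).1
      rw [abs_of_nonneg (by linarith)] at h2 h3
      linarith [bal_add (P := P) b a A y, bal_add (P := P) b A B y]
    have hz'1 : a < z' := haA.trans_lt hz'.1
    have hz'2 : z' < max z (a + s) := hz'.2.trans_le (min_le_right _ _)
    have hi : P.Inner z' := inner_of_mem_of_mem haI hcI' hz'1 hz'2
    have hbw : b ≤ P.w z' := by
      by_contra hcon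
      rw [kern_of_inner hi, if_neg hcon] at hk
      split_ifs at hk <;> linarith
    have hd : |z - z'| ≤ s₀ := by
      have h1 : z - s < z' := (le_max_right _ _).trans_lt hz'.1
      have h2 : z' < z + s := hz'2.trans_le (max_le (by linarith) (by linarith [hzw.1]))
      rw [abs_le]
      constructor <;> linarith
    have := hmod z hz z' hi.mem ⟨by linarith [hzw.1], hzw.2.trans hr⟩
      ⟨by linarith, by linarith [hz'.2, hy.2]⟩ hd
    linarith [(abs_lt.1 this).1]
  have hkern : ∀ z ∈ Ioo a η, P.kern (b - ε) z ≤ -1 := fun z hz => by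
    have hl : z ∉ lowerBounds P.I := fun h => (h haI).not_gt hz.1
    by_cases hu : z ∈ upperBounds P.I
    · exact (kern_of_ub hu hl).le
    · have hi : P.Inner z := ⟨hl, hu⟩
      have h1 := hw z hi.mem ⟨hz.1.le, hz.2.le⟩
      rw [kern_of_inner hi, if_neg (by linarith [P.le z hi.mem]), if_pos h1.le]
      norm_num
  have hH : P.PH (b - ε) ξ η := by
    refine ⟨?_, fun y' hy' => ?_⟩
    · by_cases hu : η ∈ upperBounds P.I
      · exact Or.inr hu
      · have hi : P.Inner η := ⟨fun h => (h haI).not_gt (by linarith), hu⟩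
        exact Or.inl ⟨hi.mem, (hw η hi.mem ⟨haη, le_rfl⟩).le⟩
    · rcases le_or_gt a y' with h1 | h1
      · have := bal_le_of_kern_le hy'.2 fun z hz => hkern z ⟨h1.trans_lt hz.1, hz.2⟩
        linarith [hy'.2]
      -- The part behind the wall adds at most a - ξ, which is less than η - a because the midpoint
      -- is right of a.
      · have h2 := bal_le_of_kern_le haη hkern
        have h3 := (abs_le.1 (abs_bal_le (P := P) (b - ε) y' a)).2
        rw [abs_of_nonneg (by linarith)] at h3
        linarith [bal_add (P := P) (b - ε) y' a η, hy'.1]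
  linarith [le_W_of_PH hξη hx hH]

theorem V_initial {x : ℝ} (hx : P.Inner x) : P.V x x = P.v x := by
  have hx' : P.Inner ((x + x) / 2) := by simpa using hx
  refine le_antisymm (V_le_of_PL le_rfl hx' ⟨Or.inl ⟨hx.mem, le_rfl⟩, fun y hy => ?_⟩) ?_
  · rw [le_antisymm hy.2 hy.1, bal_self]
  · refine le_of_forall_gt_imp_ge_of_dense fun b hb => ?_
    exact (PL_of_V_lt le_rfl hx' hb).1.elim (fun h => h.2) (fun h => absurd h hx.1)

theorem W_initial {x : ℝ} (hx : P.Inner x) : P.W x x = P.w x := by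
  rw [W, V_initial (inner_reflect.2 (by simpa using hx))]
  simp [reflect]

/-- Comparison principle with domain of dependence. -/
theorem V_le_of_data_le {Q : Profile} (hI : Q.I = P.I) {c ξ η : ℝ} (hξη : ξ ≤ η)
    (hx : P.Inner ((ξ + η) / 2))
    (hv : ∀ z ∈ P.I, z ∈ Icc ξ η → Q.v z ≤ P.v z + c)
    (hw : ∀ z ∈ P.I, z ∈ Icc ξ η → Q.w z ≤ P.w z + c) : Q.V ξ η ≤ P.V ξ η + c := by
  have hx' : Q.Inner ((ξ + η) / 2) := by rwa [Inner, hI]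
  rw [← sub_le_iff_le_add]
  refine le_of_forall_gt_imp_ge_of_dense fun b hb => ?_
  rw [sub_le_iff_le_add]
  obtain ⟨h1, h2⟩ := PL_of_V_lt hξη hx hb
  -- The density of `Q` at level b + c dominates that of `P` at level b, so survival is inherited.
  refine V_le_of_PL hξη hx' ⟨?_, fun y hy => (h2 y hy).trans (bal_mono_of_kern hy.1 fun z hz => ?_)⟩
  · rw [low, hI]
    exact h1.imp (fun h => ⟨h.1, by linarith [hv ξ h.1 ⟨le_rfl, hξη⟩, h.2]⟩) id
  · have hzw : z ∈ Icc ξ η := ⟨hz.1.le, hz.2.le.trans hy.2⟩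
    exact kern_mono_data hI (fun hi h => by linarith [hv z hi.mem hzw])
      (fun hi h => by linarith [hw z hi.mem hzw])

theorem W_le_of_data_le {Q : Profile} (hI : Q.I = P.I) {c ξ η : ℝ} (hξη : ξ ≤ η)
    (hx : P.Inner ((ξ + η) / 2))
    (hv : ∀ z ∈ P.I, z ∈ Icc ξ η → Q.v z ≤ P.v z + c)
    (hw : ∀ z ∈ P.I, z ∈ Icc ξ η → Q.w z ≤ P.w z + c) : Q.W ξ η ≤ P.W ξ η + c := by
  have hn : ∀ {z}, z ∈ Icc (-η) (-ξ) → -z ∈ Icc ξ η := fun h =>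
    ⟨by linarith [h.2], by linarith [h.1]⟩
  have := V_le_of_data_le (P := Q.reflect) (Q := P.reflect) (c := c) (by simp [reflect, hI])
    (neg_le_neg hξη) (inner_reflect_mid (by rwa [Inner, hI]))
    (fun z hz hzw => by
      have := hw (-z) (hI ▸ hz) (hn hzw)
      simp only [reflect]
      linarith)
    (fun z hz hzw => by
      have := hv (-z) (hI ▸ hz) (hn hzw)
      simp only [reflect]
      linarith)
  simp only [W]
  linarith

end Profile

/-! ### Continuous extension and agreement with the stated formulas -/

/-- A function on a dense set which has small oscillation near every point extends to a continuous
function. -/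
theorem exists_continuous_extension {X : Type*} [TopologicalSpace X] {A : Set X} (hA : Dense A)
    (g : X → ℝ) (h : ∀ p, ∀ ε > 0, ∃ U ∈ 𝓝 p, ∀ x ∈ U ∩ A, ∀ y ∈ U ∩ A, g x ≤ g y + ε) :
    ∃ u : C(X, ℝ), ∀ p ∈ A, u p = g p := by
  have hlim : ∀ p, ∃ y, Tendsto g (𝓝[A] p) (𝓝 y) := fun p => by
    have : (𝓝[A] p).NeBot := mem_closure_iff_nhdsWithin_neBot.1 (hA p)
    refine cauchy_map_iff_exists_tendsto.1 (Metric.cauchy_iff.2 ⟨inferInstance, fun ε hε => ?_⟩)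
    obtain ⟨U, hU, hUA⟩ := h p (ε / 2) (half_pos hε)
    refine ⟨g '' (U ∩ A), image_mem_map (inter_mem (mem_nhdsWithin_of_mem_nhds hU)
      self_mem_nhdsWithin), ?_⟩
    rintro _ ⟨x, hx, rfl⟩ _ ⟨y, hy, rfl⟩
    rw [Real.dist_eq, abs_lt]
    constructor <;> linarith [hUA x hx y hy, hUA y hy x hx]
  refine ⟨⟨extendFrom A g, continuous_extendFrom hA hlim⟩, fun p hp => ?_⟩
  refine extendFrom_eq (subset_closure hp) ?_
  rw [Metric.tendsto_nhds]
  intro ε hε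
  obtain ⟨U, hU, hUA⟩ := h p (ε / 2) (half_pos hε)
  filter_upwards [inter_mem (mem_nhdsWithin_of_mem_nhds hU) self_mem_nhdsWithin] with x hx
  have hpU : p ∈ U ∩ A := ⟨mem_of_mem_nhds hU, hp⟩
  rw [Real.dist_eq, abs_lt]
  constructor <;> linarith [hUA x hx p hpU, hUA p hpU x hx]

variable {I : Set ℝ}

theorem extend_apply_mem (g : C(I, ℝ)) {z : ℝ} (hz : z ∈ I) :
    Function.extend Subtype.val g 0 z = g ⟨z, hz⟩ :=
  Subtype.val_injective.extend_apply g 0 ⟨z, hz⟩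

theorem continuousOn_extend (g : C(I, ℝ)) :
    ContinuousOn (Function.extend Subtype.val g 0) I := by
  rw [continuousOn_iff_continuous_domRestrict]
  convert g.continuous using 1
  ext z
  exact extend_apply_mem g z.2

theorem mem_frontier_of_mem_lowerBounds {a : ℝ} (ha : a ∈ I) (h : a ∈ lowerBounds I) :
    a ∈ frontier I := by
  refine ⟨subset_closure ha, fun hi => ?_⟩
  obtain ⟨e, he, hb⟩ := Metric.isOpen_iff.1 isOpen_interior a hi
  have := h (interior_subset (hb (by
    rw [Metric.mem_ball, Real.dist_eq, abs_lt]; constructor <;> linarith : a - e / 2 ∈ _)))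
  linarith

theorem mem_frontier_of_mem_upperBounds {a : ℝ} (ha : a ∈ I) (h : a ∈ upperBounds I) :
    a ∈ frontier I := by
  refine ⟨subset_closure ha, fun hi => ?_⟩
  obtain ⟨e, he, hb⟩ := Metric.isOpen_iff.1 isOpen_interior a hi
  have := h (interior_subset (hb (by
    rw [Metric.mem_ball, Real.dist_eq, abs_lt]; constructor <;> linarith : a + e / 2 ∈ _)))
  linarith

/-- The profile of an initial condition. -/
def profile (hc : IsClosed I) (ho : I.OrdConnected) {f : C(I, ℝ) × C(I, ℝ)}
    (hf : f ∈ InitialData I) : Profile where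
  I := I
  v := Function.extend Subtype.val f.1 0
  w := Function.extend Subtype.val f.2 0
  ordConnected := ho
  isClosed := hc
  contV := continuousOn_extend f.1
  contW := continuousOn_extend f.2
  le x hx := by
    rw [extend_apply_mem f.1 hx, extend_apply_mem f.2 hx]
    exact hf.1 _
  eqLow a ha h := by
    rw [extend_apply_mem f.1 ha, extend_apply_mem f.2 ha]
    exact hf.2 _ (mem_frontier_of_mem_lowerBounds ha h)
  eqHigh a ha h := by
    rw [extend_apply_mem f.1 ha, extend_apply_mem f.2 ha]
    exact hf.2 _ (mem_frontier_of_mem_upperBounds ha h)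

section Formula

variable (hc : IsClosed I) (ho : I.OrdConnected) {f : C(I, ℝ) × C(I, ℝ)} (hf : f ∈ InitialData I)

theorem profile_low (b : ℝ) : (profile hc ho hf).low b = lowSet f.1 b := by
  ext z
  refine or_congr ⟨fun ⟨h1, h2⟩ => ⟨h1, ?_⟩, fun ⟨h1, h2⟩ => ⟨h1, ?_⟩⟩ Iff.rfl
  · rwa [← extend_apply_mem f.1 h1]
  · rwa [← extend_apply_mem f.1 h1] at h2

theorem profile_high (b : ℝ) : (profile hc ho hf).high b = highSet f.2 b := by
  ext z
  refine or_congr ⟨fun ⟨h1, h2⟩ => ⟨h1, ?_⟩, fun ⟨h1, h2⟩ => ⟨h1, ?_⟩⟩ Iff.rfl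
  · rwa [← extend_apply_mem f.2 h1]
  · rwa [← extend_apply_mem f.2 h1] at h2

/-- `kern` disregards the data at the endpoints of I. It can differ from the indicators only where
two of I, its lower bounds and its upper bounds meet, and each of these intersections has at most
one point. -/
theorem profile_bal (hne : I.Nonempty) (b x y : ℝ) :
    (profile hc ho hf).bal b x y = balance f b x y := by
  refine intervalIntegral.integral_congr_ae ?_
  have h1 : (I ∩ lowerBounds I).Subsingleton := fun z hz z' hz' =>
    le_antisymm (hz.2 hz'.1) (hz'.2 hz.1)
  have h2 : (I ∩ upperBounds I).Subsingleton := fun z hz z' hz' =>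
    le_antisymm (hz'.2 hz.1) (hz.2 hz'.1)
  have h3 : (lowerBounds I ∩ upperBounds I).Subsingleton := fun z hz z' hz' => by
    obtain ⟨i, hi⟩ := hne
    linarith [hz.1 hi, hz.2 hi, hz'.1 hi, hz'.2 hi]
  filter_upwards [compl_mem_ae_iff.2 (h1.measure_zero volume),
    compl_mem_ae_iff.2 (h2.measure_zero volume), compl_mem_ae_iff.2 (h3.measure_zero volume)]
    with z hz1 hz2 hz3 _
  have e1 : z ∈ lowSet f.1 b ↔
      z ∈ lowerBounds I ∨ (z ∉ upperBounds I ∧ Function.extend Subtype.val f.1 0 z ≤ b) := by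
    rw [← profile_low hc ho hf]
    constructor
    · rintro (h | h)
      · exact Or.inr ⟨fun h' => hz2 ⟨h.1, h'⟩, h.2⟩
      · exact Or.inl h
    · rintro (h | h)
      · exact Or.inr h
      · by_cases hl : z ∈ lowerBounds I
        · exact Or.inr hl
        · exact Or.inl ⟨Profile.Inner.mem (P := profile hc ho hf) ⟨hl, h.1⟩, h.2⟩
  have e2 : z ∈ highSet f.2 b ↔
      z ∈ upperBounds I ∨ (z ∉ lowerBounds I ∧ b ≤ Function.extend Subtype.val f.2 0 z) := by
    rw [← profile_high hc ho hf]
    constructor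
    · rintro (h | h)
      · exact Or.inr ⟨fun h' => hz1 ⟨h.1, h'⟩, h.2⟩
      · exact Or.inl h
    · rintro (h | h)
      · exact Or.inr h
      · by_cases hu : z ∈ upperBounds I
        · exact Or.inr hu
        · exact Or.inl ⟨Profile.Inner.mem (P := profile hc ho hf) ⟨h.1, hu⟩, h.2⟩
  classical
  rw [indicator_apply, indicator_apply, if_congr e1 rfl rfl, if_congr e2 rfl rfl]
  unfold Profile.kern profile
  congr

theorem mem_evolvedLow_iff {x b t : ℝ} (hx : x ∈ I) :
    x ∈ evolvedLow f b t ↔ (profile hc ho hf).PL b (x - t) (x + t) := by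
  set P := profile hc ho hf
  have hal : ∀ x', ((x' + 2 * t : ℝ) : EReal) ≤ alphaV f b x' ↔
      ∀ y ∈ Icc x' (x' + 2 * t), 0 ≤ P.bal b x' y := by
    intro x'
    simp only [alphaV, le_iInf_iff, EReal.coe_le_coe_iff]
    simp only [← profile_bal hc ho hf ⟨x, hx⟩]
    constructor
    · intro h y hy
      by_contra! hneg
      have hne : x' ≠ y := fun e => by rw [← e, Profile.bal_self] at hneg; exact lt_irrefl _ hneg
      have hlt : x' < y := hy.1.lt_of_ne hne
      -- The bound on the infimum leaves y = x' + 2t open; continuity of the mass gives a negative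
      -- value at some y' < y, so this endpoint is covered too.
      obtain ⟨y', h1, h2⟩ := exists_between
        (max_lt hlt (by linarith : y + P.bal b x' y < y))
      have h3 := (le_max_left _ _).trans h1.le
      have h4 := (le_max_right _ _).trans_lt h1
      have h5 := (abs_le.1 (Profile.abs_bal_le (P := P) b y' y)).1
      rw [abs_of_nonneg (by linarith)] at h5
      have := h y' ⟨h3, by linarith [Profile.bal_add (P := P) b x' y' y]⟩
      linarith [hy.2]
    · rintro h y ⟨h1, h2⟩
      by_contra! hlt
      linarith [h y ⟨h1, hlt.le⟩]
  constructor
  · rintro ⟨_, x', e, h1, h2⟩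
    obtain rfl : x' = x - t := by linarith
    rw [hal, show x - t + 2 * t = x + t by ring] at h2
    exact ⟨by rwa [profile_low], h2⟩
  · rintro ⟨h1, h2⟩
    refine ⟨hx, x - t, by ring, by rwa [profile_low] at h1, ?_⟩
    rw [hal, show x - t + 2 * t = x + t by ring]
    exact h2

theorem mem_evolvedHigh_iff {x b t : ℝ} (hx : x ∈ I) :
    x ∈ evolvedHigh f b t ↔ (profile hc ho hf).PH b (x - t) (x + t) := by
  set P := profile hc ho hf
  have hal : ∀ x', alphaW f b x' ≤ ((x' - 2 * t : ℝ) : EReal) ↔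
      ∀ y ∈ Icc (x' - 2 * t) x', P.bal b y x' ≤ 0 := by
    intro x'
    simp only [alphaW, iSup_le_iff, EReal.coe_le_coe_iff]
    simp only [← profile_bal hc ho hf ⟨x, hx⟩]
    constructor
    · intro h y hy
      by_contra! hneg
      have hne : y ≠ x' := fun e => by rw [← e, Profile.bal_self] at hneg; exact lt_irrefl _ hneg
      have hlt : y < x' := hy.2.lt_of_ne hne
      obtain ⟨y', h1, h2⟩ := exists_between
        (lt_min hlt (by linarith : y < y + P.bal b y x'))
      have h3 := h2.le.trans (min_le_left _ _)
      have h4 := h2.trans_le (min_le_right _ _)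
      have h5 := (abs_le.1 (Profile.abs_bal_le (P := P) b y y')).2
      rw [abs_of_nonneg (by linarith)] at h5
      have := h y' ⟨h3, by linarith [Profile.bal_add (P := P) b y y' x']⟩
      linarith [hy.1]
    · rintro h y ⟨h1, h2⟩
      by_contra! hlt
      linarith [h y ⟨hlt.le, h1⟩]
  constructor
  · rintro ⟨_, x', e, h1, h2⟩
    obtain rfl : x' = x + t := by linarith
    rw [hal, show x + t - 2 * t = x - t by ring] at h2
    exact ⟨by rwa [profile_high], h2⟩
  · rintro ⟨h1, h2⟩
    refine ⟨hx, x + t, by ring, by rwa [profile_high] at h1, ?_⟩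
    rw [hal, show x + t - 2 * t = x - t by ring]
    exact h2

theorem vStar_eq {x t : ℝ} (ht : 0 ≤ t) (hx : (profile hc ho hf).Inner x) :
    vStar f x t = ((profile hc ho hf).V (x - t) (x + t) : ℝ) := by
  have hle : x - t ≤ x + t := by linarith
  refine le_antisymm (le_of_forall_gt_imp_ge_of_dense fun c h => ?_) (le_iInf₂ fun b hb => ?_)
  · obtain ⟨b, h1, h2⟩ := EReal.lt_iff_exists_real_btwn.1 h
    refine le_trans (iInf₂_le b ?_) h2.le
    exact (mem_evolvedLow_iff hc ho hf hx.mem).2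
      (Profile.PL_of_V_lt hle (hx.mid t) (EReal.coe_lt_coe_iff.1 h1))
  · exact EReal.coe_le_coe_iff.2
      (Profile.V_le_of_PL hle (hx.mid t) ((mem_evolvedLow_iff hc ho hf hx.mem).1 hb))

theorem wStar_eq {x t : ℝ} (ht : 0 ≤ t) (hx : (profile hc ho hf).Inner x) :
    wStar f x t = ((profile hc ho hf).W (x - t) (x + t) : ℝ) := by
  have hle : x - t ≤ x + t := by linarith
  refine le_antisymm (iSup₂_le fun b hb => ?_) (le_of_forall_lt_imp_le_of_dense fun c h => ?_)
  · exact EReal.coe_le_coe_iff.2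
      (Profile.le_W_of_PH hle (hx.mid t) ((mem_evolvedHigh_iff hc ho hf hx.mem).1 hb))
  · obtain ⟨b, h1, h2⟩ := EReal.lt_iff_exists_real_btwn.1 h
    refine h1.le.trans (le_iSup₂ (f := fun (b : ℝ) (_ : b ∈ {b : ℝ | x ∈ evolvedHigh f b t}) =>
      (b : EReal)) b ?_)
    exact (mem_evolvedHigh_iff hc ho hf hx.mem).2
      (Profile.PH_of_lt_W hle (hx.mid t) (EReal.coe_lt_coe_iff.1 h2))

end Formula

/-! ### Determination by the base along characteristics -/

/-- A function on a triangle which is transported with speed `c` in the rectangles contained in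
its interior is determined by its values on the base. -/
theorem eq_base_of_transported {F : SpaceTime I → ℝ} {c s x₁ x₂ : ℝ} (hc : |c| ≤ 1) (hs : 0 ≤ s)
    (hI : Ioo x₁ x₂ ⊆ I) (hF : ContinuousOn F (triangle I s x₁ x₂))
    (htr : ∀ y₁ y₂ t₁ t₂ : ℝ, Ioo y₁ y₂ ⊆ I → 0 ≤ t₁ →
      rect I y₁ y₂ t₁ t₂ ⊆ {p ∈ triangle I s x₁ x₂ | s < p.2} →
      ∀ p ∈ rect I y₁ y₂ t₁ t₂, ∀ q ∈ rect I y₁ y₂ t₁ t₂,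
        (q.1 : ℝ) - p.1 = c * (q.2 - p.2) → F q = F p)
    {p q : SpaceTime I} (hp : p ∈ triangle I s x₁ x₂) (hps : s < p.2) (hq : (q.2 : ℝ) = s)
    (hpq : (p.1 : ℝ) - q.1 = c * (p.2 - s)) : F p = F q := by
  obtain ⟨hc1, hc2⟩ := abs_le.1 hc
  obtain ⟨hp0, hp1, hp2⟩ := hp
  have hmem : ∀ τ ∈ Icc s (p.2 : ℝ), x₁ + (τ - s) < q.1 + c * (τ - s) ∧
      q.1 + c * (τ - s) < x₂ - (τ - s) := by
    intro τ hτ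
    have e : (q.1 : ℝ) = p.1 - c * (p.2 - s) := by linarith
    rw [e]
    constructor
    · nlinarith [mul_nonneg (by linarith : 0 ≤ 1 - c) (by linarith [hτ.2] : 0 ≤ p.2 - τ)]
    · nlinarith [mul_nonneg (by linarith : 0 ≤ 1 + c) (by linarith [hτ.2] : 0 ≤ p.2 - τ)]
  have hIoo : ∀ τ : Icc s (p.2 : ℝ), (q.1 : ℝ) + c * (τ - s) ∈ I := fun τ =>
    hI ⟨by linarith [(hmem τ τ.2).1, τ.2.1], by linarith [(hmem τ τ.2).2, τ.2.1]⟩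
  -- γ is the characteristic from q to p. F is locally constant along it at times strictly between,
  -- so continuity up to both ends and the mean value theorem give equal end values.
  let γ : Icc s (p.2 : ℝ) → SpaceTime I := fun τ => (⟨_, hIoo τ⟩, ⟨τ, hs.trans τ.2.1⟩)
  have hγ : Continuous γ := by
    refine Continuous.prodMk (Continuous.subtype_mk (by fun_prop) _)
      (Continuous.subtype_mk (by fun_prop) _)
  have hγm : ∀ τ, γ τ ∈ triangle I s x₁ x₂ := fun τ => ⟨τ.2.1, hmem τ τ.2⟩
  have hcont : Continuous (fun τ => F (γ τ)) := by
    rw [continuous_iff_continuousAt]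
    intro τ
    have := (hF (γ τ) (hγm τ)).tendsto
    exact this.comp (tendsto_nhdsWithin_iff.2 ⟨hγ.tendsto τ, Eventually.of_forall hγm⟩)
  let h : ℝ → ℝ := IccExtend hps.le (fun τ => F (γ τ))
  have hh : ∀ τ (hτ : τ ∈ Icc s (p.2 : ℝ)), h τ = F (γ ⟨τ, hτ⟩) := fun τ hτ =>
    IccExtend_of_mem _ _ hτ
  have hloc : ∀ τ ∈ Ioo s (p.2 : ℝ), HasDerivAt h 0 τ := by
    intro τ hτ
    have hτ' : τ ∈ Icc s (p.2 : ℝ) := Ioo_subset_Icc_self hτ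
    obtain ⟨h1, h2⟩ := hmem τ hτ'
    set y := (q.1 : ℝ) + c * (τ - s) with hy
    -- The factor 2 accounts for the half-width r and for the sides of the triangle, which move in
    -- by another r up to the top of the rectangle.
    obtain ⟨r, hr0, hr1, hr2, hr3, hr4⟩ : ∃ r > 0, 2 * r ≤ y - (x₁ + (τ - s)) ∧
        2 * r ≤ x₂ - (τ - s) - y ∧ r ≤ τ - s ∧ r ≤ p.2 - τ := by
      refine ⟨min (min (y - (x₁ + (τ - s))) (x₂ - (τ - s) - y)) (min (τ - s) (p.2 - τ)) / 2,
        half_pos (lt_min (lt_min (by linarith) (by linarith))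
          (lt_min (by linarith [hτ.1]) (by linarith [hτ.2]))), ?_⟩
      have a1 := min_le_left (min (y - (x₁ + (τ - s))) (x₂ - (τ - s) - y)) (min (τ - s) (p.2 - τ))
      have a2 := min_le_right (min (y - (x₁ + (τ - s))) (x₂ - (τ - s) - y)) (min (τ - s) (p.2 - τ))
      have a3 := min_le_left (y - (x₁ + (τ - s))) (x₂ - (τ - s) - y)
      have a4 := min_le_right (y - (x₁ + (τ - s))) (x₂ - (τ - s) - y)
      have a5 := min_le_left (τ - s) (p.2 - τ)
      have a6 := min_le_right (τ - s) (p.2 - τ)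
      refine ⟨by linarith, by linarith, by linarith [hτ.1], by linarith [hτ.2]⟩
    have hsub : Ioo (y - r) (y + r) ⊆ I := fun z hz =>
      hI ⟨by linarith [hz.1, hτ.1], by linarith [hz.2, hτ.1]⟩
    have hrect : rect I (y - r) (y + r) (τ - r) (τ + r) ⊆
        {p ∈ triangle I s x₁ x₂ | s < p.2} := by
      rintro z ⟨hz1, hz2⟩
      exact ⟨⟨by linarith [hz2.1], by linarith [hz1.1, hz2.2], by linarith [hz1.2, hz2.2]⟩,
        by linarith [hz2.1]⟩
    have heq : h =ᶠ[𝓝 τ] fun _ => h τ := by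
      filter_upwards [Ioo_mem_nhds (by linarith : τ - r < τ) (by linarith : τ < τ + r)] with σ hσ
      have hσ' : σ ∈ Icc s (p.2 : ℝ) := ⟨by linarith [hσ.1], by linarith [hσ.2]⟩
      rw [hh σ hσ', hh τ hτ']
      refine htr (y - r) (y + r) (τ - r) (τ + r) hsub (by linarith) hrect (γ ⟨τ, hτ'⟩) ?_
        (γ ⟨σ, hσ'⟩) ?_ ?_
      · exact ⟨⟨show y - r < y by linarith, show y < y + r by linarith⟩,
          ⟨show τ - r < τ by linarith, show τ < τ + r by linarith⟩⟩
      · have habs : |c * (σ - τ)| ≤ |σ - τ| := by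
          rw [abs_mul]
          exact mul_le_of_le_one_left (abs_nonneg _) hc
        have hlt : |σ - τ| < r := abs_lt.2 ⟨by linarith [hσ.1], by linarith [hσ.2]⟩
        obtain ⟨h3, h4⟩ := abs_lt.1 (habs.trans_lt hlt)
        have e : (q.1 : ℝ) + c * (σ - s) = y + c * (σ - τ) := by rw [hy]; ring
        refine ⟨?_, hσ⟩
        change (q.1 : ℝ) + c * (σ - s) ∈ _
        rw [e]
        exact ⟨by linarith, by linarith⟩
      · change (q.1 : ℝ) + c * (σ - s) - (q.1 + c * (τ - s)) = c * (σ - τ)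
        ring
    exact (hasDerivAt_const τ (h τ)).congr_of_eventuallyEq heq
  obtain ⟨σ, hσ, hslope⟩ := exists_hasDerivAt_eq_slope h (fun _ => 0) hps
    (hcont.Icc_extend' (h := hps.le)).continuousOn hloc
  have hend : h p.2 = h s := by
    have hne : (p.2 : ℝ) - s ≠ 0 := by linarith
    field_simp at hslope
    linarith
  rw [hh _ ⟨hps.le, le_rfl⟩, hh _ ⟨le_rfl, hps.le⟩] at hend
  have e1 : γ ⟨p.2, hps.le, le_rfl⟩ = p := by
    refine Prod.ext (Subtype.ext ?_) (Subtype.ext rfl)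
    change (q.1 : ℝ) + c * (p.2 - s) = p.1
    linarith
  have e2 : γ ⟨s, le_rfl, hps.le⟩ = q := by
    refine Prod.ext (Subtype.ext ?_) (Subtype.ext hq.symm)
    change (q.1 : ℝ) + c * (s - s) = q.1
    ring
  rwa [e1, e2] at hend

namespace Profile

variable {P : Profile}

theorem V_le_W_add_of_right_wall {a : ℝ} (haI : a ∈ P.I) (hau : a ∈ upperBounds P.I) {c : ℝ}
    (hcI : c ∈ P.I) (hca : c < a) (l r : ℝ) {ε : ℝ} (hε : 0 < ε) : ∃ s > 0, ∀ ξ η, l ≤ ξ →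
      a ≤ η → η ≤ r → P.Inner ((ξ + η) / 2) → 2 * a - s ≤ ξ + η → P.V ξ η ≤ P.W ξ η + ε := by
  obtain ⟨s, hs, h⟩ := V_le_W_add_of_wall (P := P.reflect) (a := -a) (by simpa [reflect] using haI)
    (neg_mem_lowerBounds.2 (by simpa using hau)) (c := -c) (by simpa [reflect] using hcI)
    (neg_lt_neg hca) (-r) (-l) hε
  refine ⟨s, hs, fun ξ η hl ha hr hx hη => ?_⟩
  have := h (-η) (-ξ) (by linarith) (by linarith) (by linarith) (inner_reflect_mid hx)
    (by linarith)
  rw [V_reflect, W_reflect, neg_neg, neg_neg] at this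
  linarith

theorem inner_iff_mem_interior {x : ℝ} : P.Inner x ↔ x ∈ interior P.I := by
  refine ⟨fun h => mem_interior.2 ⟨_, fun z hz => Inner.mem hz, isOpen_inner, h⟩,
    fun h => ⟨fun hl => ?_, fun hu => ?_⟩⟩
  · exact (mem_frontier_of_mem_lowerBounds (interior_subset h) hl).2 h
  · exact (mem_frontier_of_mem_upperBounds (interior_subset h) hu).2 h

end Profile

/-! ### The solution for arbitrary continuous data -/

open Profile

variable {I : Set ℝ}

theorem box_mem_nhds (p : SpaceTime I) {δ : ℝ} (hδ : 0 < δ) :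
    {q : SpaceTime I | |(q.1 : ℝ) - p.1| < δ ∧ |(q.2 : ℝ) - p.2| < δ} ∈ 𝓝 p := by
  have h1 : IsOpen {q : SpaceTime I | |(q.1 : ℝ) - p.1| < δ} :=
    isOpen_lt (by fun_prop) (by fun_prop)
  have h2 : IsOpen {q : SpaceTime I | |(q.2 : ℝ) - p.2| < δ} :=
    isOpen_lt (by fun_prop) (by fun_prop)
  refine (h1.inter h2).mem_nhds ?_
  simp [hδ]

theorem dense_interior (hd : I ⊆ closure (interior I)) :
    Dense {x : I | (x : ℝ) ∈ interior I} := by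
  rw [Subtype.dense_iff]
  refine hd.trans (closure_mono fun x hx => ⟨⟨x, interior_subset hx⟩, hx, rfl⟩)

theorem dense_interior_spaceTime (hd : I ⊆ closure (interior I)) :
    Dense {p : SpaceTime I | (p.1 : ℝ) ∈ interior I} :=
  (dense_interior hd).preimage isOpenMap_fst

section Construction

variable (hc : IsClosed I) (ho : I.OrdConnected) {f : C(I, ℝ) × C(I, ℝ)} (hf : f ∈ InitialData I)

theorem exists_extension_V (hd : I ⊆ closure (interior I)) : ∃ u : C(SpaceTime I, ℝ),
    ∀ p : SpaceTime I, (p.1 : ℝ) ∈ interior I →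
      u p = (profile hc ho hf).V (p.1 - p.2) (p.1 + p.2) := by
  refine exists_continuous_extension (dense_interior_spaceTime hd) _ fun p ε hε => ?_
  obtain ⟨s, hs, h⟩ := V_stable (P := profile hc ho hf) (p.1 - p.2 - 2) (p.1 + p.2 + 2) hε
  -- Two points of the box differ by at most s / 2 in space and in time, hence by at most s in each
  -- characteristic coordinate.
  refine ⟨_, box_mem_nhds p (lt_min one_pos (by linarith : 0 < s / 4)), ?_⟩
  rintro x ⟨⟨hx1, hx2⟩, hxA⟩ y ⟨⟨hy1, hy2⟩, hyA⟩
  have m1 := min_le_left 1 (s / 4)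
  have m2 := min_le_right 1 (s / 4)
  rw [abs_lt] at hx1 hx2 hy1 hy2
  have hx0 := x.2.2
  have hy0 := y.2.2
  exact h _ _ _ _ (by linarith) (by linarith) (by linarith) (by linarith)
    (by rw [abs_le]; constructor <;> linarith) (by linarith)
    ((inner_iff_mem_interior.2 hyA).mid _) ((inner_iff_mem_interior.2 hxA).mid _)

theorem exists_extension_W (hd : I ⊆ closure (interior I)) : ∃ u : C(SpaceTime I, ℝ),
    ∀ p : SpaceTime I, (p.1 : ℝ) ∈ interior I →
      u p = (profile hc ho hf).W (p.1 - p.2) (p.1 + p.2) := by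
  refine exists_continuous_extension (dense_interior_spaceTime hd) _ fun p ε hε => ?_
  obtain ⟨s, hs, h⟩ := W_stable (P := profile hc ho hf) (p.1 - p.2 - 2) (p.1 + p.2 + 2) hε
  refine ⟨_, box_mem_nhds p (lt_min one_pos (by linarith : 0 < s / 4)), ?_⟩
  rintro x ⟨⟨hx1, hx2⟩, hxA⟩ y ⟨⟨hy1, hy2⟩, hyA⟩
  have m1 := min_le_left 1 (s / 4)
  have m2 := min_le_right 1 (s / 4)
  rw [abs_lt] at hx1 hx2 hy1 hy2
  have hx0 := x.2.2
  have hy0 := y.2.2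
  exact h _ _ _ _ (by linarith) (by linarith) (by linarith) (by linarith)
    (by rw [abs_le]; constructor <;> linarith) (by linarith)
    ((inner_iff_mem_interior.2 hxA).mid _) ((inner_iff_mem_interior.2 hyA).mid _)

/-- The functions given by the formulas, continued to the frontier. -/
def IsFormula (u : C(SpaceTime I, ℝ) × C(SpaceTime I, ℝ)) : Prop :=
  ∀ p : SpaceTime I, (p.1 : ℝ) ∈ interior I →
    u.1 p = (profile hc ho hf).V (p.1 - p.2) (p.1 + p.2) ∧
      u.2 p = (profile hc ho hf).W (p.1 - p.2) (p.1 + p.2)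

variable {hc ho hf} {u : C(SpaceTime I, ℝ) × C(SpaceTime I, ℝ)}

namespace IsFormula

theorem hasInitialValue (hu : IsFormula hc ho hf u) (hd : I ⊆ closure (interior I)) :
    HasInitialValue u f := by
  have h1 : (fun x : I => u.1 (x, 0)) = f.1 :=
    Continuous.ext_on (dense_interior hd) (by fun_prop) f.1.continuous fun x hx => by
      have := (hu (x, 0) hx).1
      simp only [NNReal.coe_zero, sub_zero, add_zero] at this
      rw [V_initial (inner_iff_mem_interior.2 hx)] at this
      exact this.trans (extend_apply_mem f.1 x.2)
  have h2 : (fun x : I => u.2 (x, 0)) = f.2 :=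
    Continuous.ext_on (dense_interior hd) (by fun_prop) f.2.continuous fun x hx => by
      have := (hu (x, 0) hx).2
      simp only [NNReal.coe_zero, sub_zero, add_zero] at this
      rw [W_initial (inner_iff_mem_interior.2 hx)] at this
      exact this.trans (extend_apply_mem f.2 x.2)
  exact fun x => ⟨congr_fun h1 x, congr_fun h2 x⟩

theorem constraint (hu : IsFormula hc ho hf u) (hd : I ⊆ closure (interior I))
    (p : SpaceTime I) : u.2 p ≤ u.1 p := by
  refine closure_minimal (s := {p : SpaceTime I | (p.1 : ℝ) ∈ interior I})
    (t := {p | u.2 p ≤ u.1 p}) (fun p hp => ?_)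
    (isClosed_le u.2.continuous u.1.continuous) (dense_interior_spaceTime hd p)
  have hi : (profile hc ho hf).Inner p.1 := inner_iff_mem_interior.2 hp
  change u.2 p ≤ u.1 p
  rw [(hu p hp).1, (hu p hp).2]
  exact W_le_V (by linarith [p.2.2]) (hi.mid _)

/-- The estimate V ≤ W + ε at interior points near the wall passes to the wall by density. Time 0 is
separate: the wall estimates need a characteristic that has reached the wall, which holds near (a,
t) only for t > 0. -/
theorem boundary (hu : IsFormula hc ho hf u) (hd : I ⊆ closure (interior I)) (p : SpaceTime I)
    (hp : (p.1 : ℝ) ∈ frontier I) : u.1 p = u.2 p := by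
  set P := profile hc ho hf with hP
  obtain ⟨⟨a, haI⟩, ⟨t, ht⟩⟩ := p
  change a ∈ frontier I at hp
  rcases ht.eq_or_lt with rfl | ht0
  · have := hu.hasInitialValue hd ⟨a, haI⟩
    exact this.1.trans ((hf.2 _ hp).trans this.2.symm)
  refine le_antisymm ?_ (hu.constraint hd _)
  obtain ⟨z, hz⟩ : (interior I).Nonempty := closure_nonempty_iff.1 ⟨a, hd haI⟩
  have hzi : P.Inner z := inner_iff_mem_interior.2 hz
  by_contra! hlt
  set p : SpaceTime I := (⟨a, haI⟩, ⟨t, ht⟩)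
  obtain ⟨ε, hε, hεlt⟩ : ∃ ε > 0, u.2 p + ε < u.1 p :=
    ⟨(u.1 p - u.2 p) / 2, by linarith, by linarith⟩
  have key : ∃ s > 0, ∀ q : SpaceTime I, (q.1 : ℝ) ∈ interior I → |(q.1 : ℝ) - a| < min (s / 2)
      (min 1 (t / 2)) → |(q.2 : ℝ) - t| < min (s / 2) (min 1 (t / 2)) →
      P.V (q.1 - q.2) (q.1 + q.2) ≤ P.W (q.1 - q.2) (q.1 + q.2) + ε := by
    have hni : ¬ P.Inner a := fun h => hp.2 (inner_iff_mem_interior.1 h)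
    have hor : a ∈ lowerBounds I ∨ a ∈ upperBounds I := by
      by_contra! h
      exact hni h
    rcases hor with hl | hu'
    · obtain ⟨s, hs, h⟩ := V_le_W_add_of_wall (P := P) haI hl (c := z) hzi.mem
        (not_le.1 fun h => hzi.1 (lb_mono hl h)) (a - t - 2) (a + t + 2) hε
      refine ⟨s, hs, fun q hq h1 h2 => ?_⟩
      simp only [lt_min_iff, abs_lt] at h1 h2
      exact h _ _ (by linarith) (by linarith) (by linarith)
        ((inner_iff_mem_interior.2 hq : P.Inner q.1).mid _) (by linarith)
    · obtain ⟨s, hs, h⟩ := V_le_W_add_of_right_wall (P := P) haI hu' (c := z) hzi.mem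
        (not_le.1 fun h => hzi.2 (ub_mono hu' h)) (a - t - 2) (a + t + 2) hε
      refine ⟨s, hs, fun q hq h1 h2 => ?_⟩
      simp only [lt_min_iff, abs_lt] at h1 h2
      exact h _ _ (by linarith) (by linarith) (by linarith)
        ((inner_iff_mem_interior.2 hq : P.Inner q.1).mid _) (by linarith)
  obtain ⟨s, hs, h⟩ := key
  have hopen : {q : SpaceTime I | u.2 q + ε < u.1 q} ∈ 𝓝 p :=
    (isOpen_lt (by fun_prop) (by fun_prop)).mem_nhds hεlt
  obtain ⟨q, ⟨⟨hq1, hq2⟩, hq3⟩, hqA⟩ := mem_closure_iff_nhds.1 (dense_interior_spaceTime hd p) _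
    (inter_mem (box_mem_nhds p (by positivity : 0 < min (s / 2) (min 1 (t / 2)))) hopen)
  have h1 := h q hqA hq1 hq2
  rw [← (hu q hqA).1, ← (hu q hqA).2] at h1
  exact (h1.trans_lt hq3).false

theorem apply_mk (hu : IsFormula hc ho hf u) {x t : ℝ} (hx : x ∈ interior I) (ht : 0 ≤ t) :
    u.1 (⟨x, interior_subset hx⟩, ⟨t, ht⟩) = (profile hc ho hf).V (x - t) (x + t) ∧
      u.2 (⟨x, interior_subset hx⟩, ⟨t, ht⟩) = (profile hc ho hf).W (x - t) (x + t) :=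
  hu (⟨x, interior_subset hx⟩, ⟨t, ht⟩) hx

theorem equations (hu : IsFormula hc ho hf u) : SatisfiesEquations u.1 u.2 univ := by
  intro x₁ x₂ t₁ t₂ hI ht₁ _
  have hint : ∀ {z}, z ∈ Ioo x₁ x₂ → z ∈ interior I := fun hz =>
    mem_interior.2 ⟨_, hI, isOpen_Ioo, hz⟩
  refine ⟨fun h p hp q hq => ?_, fun h p hp q hq hpq => ?_⟩
  · have hth : ∀ z ∈ Ioo x₁ x₂, ∀ τ ∈ Ioo t₁ t₂,
        (profile hc ho hf).W (z - τ) (z + τ) < (profile hc ho hf).V (z - τ) (z + τ) := by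
      intro z hz τ hτ
      have h0 : 0 ≤ τ := ht₁.trans hτ.1.le
      rw [← (hu.apply_mk (hint hz) h0).1, ← (hu.apply_mk (hint hz) h0).2]
      exact h _ ⟨hz, hτ⟩
    rw [(hu p (hint hp.1)).1, (hu p (hint hp.1)).2, (hu q (hint hq.1)).1, (hu q (hint hq.1)).2]
    exact ⟨V_eq_of_thawed hI ht₁ hth hp.1 hp.2 hq.1 hq.2,
      W_eq_of_thawed hI ht₁ hth hp.1 hp.2 hq.1 hq.2⟩
  · have hfr : ∀ z ∈ Ioo x₁ x₂, ∀ τ ∈ Ioo t₁ t₂,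
        (profile hc ho hf).V (z - τ) (z + τ) = (profile hc ho hf).W (z - τ) (z + τ) := by
      intro z hz τ hτ
      have h0 : 0 ≤ τ := ht₁.trans hτ.1.le
      rw [← (hu.apply_mk (hint hz) h0).1, ← (hu.apply_mk (hint hz) h0).2]
      exact h _ ⟨hz, hτ⟩
    have h1 : u.1 q = u.1 p := by
      rw [(hu p (hint hp.1)).1, (hu q (hint hq.1)).1, hpq]
      exact V_eq_of_frozen hI ht₁ hfr hp.1 hp.2 hq.2
    exact ⟨h1, by rw [← h q hq, ← h p hp, h1]⟩

/-- In the triangle (v', w') is transported from the base. Its strict inequality where the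
characteristics from y < z meet says that W at (z, s) is below V at (y, s). This separation is the
hypothesis of `V_eq_of_base` and `W_eq_of_base`, so (V, W) undergoes the same transport. -/
theorem thaws (hu : IsFormula hc ho hf u) : ThawsWhenPossible u.1 u.2 := by
  intro s x₁ x₂ hs hx hI v' w' hv' hw' heq hle hlt hbase p hp hps
  have hint : ∀ {z}, z ∈ Ioo x₁ x₂ → (profile hc ho hf).Inner z := fun hz =>
    inner_of_mem_Ioo hI hz
  have hbmem : ∀ q : SpaceTime I, (q.2 : ℝ) = s → (q.1 : ℝ) ∈ Ioo x₁ x₂ →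
      q ∈ triangle I s x₁ x₂ := fun q hq hq' =>
    ⟨hq.ge, by rw [hq]; linarith [hq'.1], by rw [hq]; linarith [hq'.2]⟩
  have hv : ∀ r ∈ triangle I s x₁ x₂, s < r.2 → ∀ q : SpaceTime I, (q.2 : ℝ) = s →
      (q.1 : ℝ) = r.1 - (r.2 - s) → v' r = u.1 q := by
    intro r hr hrs q hq hrq
    rw [eq_base_of_transported (c := 1) (by simp) hs hI hv' (fun y₁ y₂ t₁ t₂ h1 h2 h3 a ha b hb h =>
      ((heq y₁ y₂ t₁ t₂ h1 h2 (h3.trans fun _ h => h.1)).1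
        (fun c hc => hlt c (h3 hc).1 (h3 hc).2) a ha b hb).1 (by linarith))
      hr hrs hq (by linarith)]
    exact (hbase q (hbmem q hq ⟨by linarith [hr.2.1], by linarith [hr.2.2]⟩) hq).1
  have hw : ∀ r ∈ triangle I s x₁ x₂, s < r.2 → ∀ q : SpaceTime I, (q.2 : ℝ) = s →
      (q.1 : ℝ) = r.1 + (r.2 - s) → w' r = u.2 q := by
    intro r hr hrs q hq hrq
    rw [eq_base_of_transported (c := -1) (by simp) hs hI hw'
      (fun y₁ y₂ t₁ t₂ h1 h2 h3 a ha b hb h =>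
        ((heq y₁ y₂ t₁ t₂ h1 h2 (h3.trans fun _ h => h.1)).1
          (fun c hc => hlt c (h3 hc).1 (h3 hc).2) a ha b hb).2 (by linarith))
      hr hrs hq (by linarith)]
    exact (hbase q (hbmem q hq ⟨by linarith [hr.2.1], by linarith [hr.2.2]⟩) hq).2
  have hsep : ∀ y ∈ Ioo x₁ x₂, ∀ z ∈ Ioo x₁ x₂, y < z →
      (profile hc ho hf).W (z - s) (z + s) < (profile hc ho hf).V (y - s) (y + s) := by
    intro y hy z hz hyz
    have hm : (y + z) / 2 ∈ I := hI ⟨by linarith [hy.1], by linarith [hz.2]⟩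
    have h0 : 0 ≤ s + (z - y) / 2 := by linarith
    have hr : ((⟨(y + z) / 2, hm⟩, ⟨s + (z - y) / 2, h0⟩) : SpaceTime I) ∈ triangle I s x₁ x₂ :=
      ⟨show s ≤ s + (z - y) / 2 by linarith,
        show x₁ + (s + (z - y) / 2 - s) < (y + z) / 2 by linarith [hy.1],
        show (y + z) / 2 < x₂ - (s + (z - y) / 2 - s) by linarith [hz.2]⟩
    have hrs : s < s + (z - y) / 2 := by linarith
    have h1 := hlt _ hr hrs
    have hyi := inner_iff_mem_interior.1 (hint hy)
    have hzi := inner_iff_mem_interior.1 (hint hz)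
    rw [hv _ hr hrs (⟨y, interior_subset hyi⟩, ⟨s, hs⟩) rfl
        (show y = (y + z) / 2 - (s + (z - y) / 2 - s) by ring),
      hw _ hr hrs (⟨z, interior_subset hzi⟩, ⟨s, hs⟩) rfl
        (show z = (y + z) / 2 + (s + (z - y) / 2 - s) by ring),
      (hu.apply_mk hyi hs).1, (hu.apply_mk hzi hs).2] at h1
    exact h1
  obtain ⟨-, hp1, hp2⟩ := id hp
  have hpm : (p.1 : ℝ) ∈ Ioo x₁ x₂ := ⟨by linarith, by linarith⟩
  have hl : (p.1 : ℝ) - (p.2 - s) ∈ Ioo x₁ x₂ := ⟨by linarith, by linarith⟩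
  have hr : (p.1 : ℝ) + (p.2 - s) ∈ Ioo x₁ x₂ := ⟨by linarith, by linarith⟩
  have hli := inner_iff_mem_interior.1 (hint hl)
  have hri := inner_iff_mem_interior.1 (hint hr)
  have hpi := inner_iff_mem_interior.1 (hint hpm)
  constructor
  · rw [hv p hp hps (⟨_, interior_subset hli⟩, ⟨s, hs⟩) rfl rfl, (hu.apply_mk hli hs).1,
      (hu p hpi).1]
    have := V_eq_of_base (P := profile hc ho hf) (s := s) (ξ := p.1 - p.2) (η := p.1 + p.2) hs
      (by linarith) (by convert hint hl using 1; ring) ((hint hpm).mid _)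
      (by convert hint hr using 1; ring) (fun z h1 h2 => by
        have := hsep _ hl z ⟨by linarith, by linarith⟩ (by linarith)
        rwa [show (p.1 : ℝ) - (p.2 - s) - s = p.1 - p.2 by ring,
          show (p.1 : ℝ) - (p.2 - s) + s = p.1 - p.2 + 2 * s by ring] at this)
    rw [this]
    congr 1 <;> ring
  · rw [hw p hp hps (⟨_, interior_subset hri⟩, ⟨s, hs⟩) rfl rfl, (hu.apply_mk hri hs).2,
      (hu p hpi).2]
    have := W_eq_of_base (P := profile hc ho hf) (s := s) (ξ := p.1 - p.2) (η := p.1 + p.2) hs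
      (by linarith) (by convert hint hr using 1; ring) ((hint hpm).mid _)
      (by convert hint hl using 1; ring) (fun z h1 h2 => by
        have := hsep z ⟨by linarith, by linarith⟩ _ hr (by linarith)
        rwa [show (p.1 : ℝ) + (p.2 - s) - s = p.1 + p.2 - 2 * s by ring,
          show (p.1 : ℝ) + (p.2 - s) + s = p.1 + p.2 by ring] at this)
    rw [this]
    congr 1 <;> ring

theorem isConstructedSolution (hu : IsFormula hc ho hf u) (hd : I ⊆ closure (interior I)) :
    IsConstructedSolution f u := by
  refine ⟨⟨hu.equations, hu.constraint hd, hu.boundary hd, hu.thaws⟩, hu.hasInitialValue hd,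
    fun x t hx => ?_⟩
  have hi : (profile hc ho hf).Inner x := inner_iff_mem_interior.2 hx
  rw [vStar_eq hc ho hf t.coe_nonneg hi, wStar_eq hc ho hf t.coe_nonneg hi]
  exact ⟨congr_arg _ (hu (x, t) hx).1, congr_arg _ (hu (x, t) hx).2⟩

/-- Contraction with domain of dependence. -/
theorem abs_sub_le (hu : IsFormula hc ho hf u) {g : C(I, ℝ) × C(I, ℝ)} {hg : g ∈ InitialData I}
    {u' : C(SpaceTime I, ℝ) × C(SpaceTime I, ℝ)} (hu' : IsFormula hc ho hg u') {c : ℝ}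
    {p : SpaceTime I} (hp : (p.1 : ℝ) ∈ interior I)
    (h : ∀ z : I, (z : ℝ) ∈ Icc (p.1 - p.2 : ℝ) (p.1 + p.2) →
      |f.1 z - g.1 z| ≤ c ∧ |f.2 z - g.2 z| ≤ c) :
    |u.1 p - u'.1 p| ≤ c ∧ |u.2 p - u'.2 p| ≤ c := by
  have hle : (p.1 - p.2 : ℝ) ≤ p.1 + p.2 := by linarith [p.2.2]
  have hi : (profile hc ho hf).Inner ((p.1 - p.2 + (p.1 + p.2)) / 2) :=
    (inner_iff_mem_interior.2 hp : (profile hc ho hf).Inner p.1).mid _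
  have hev : ∀ {k : C(I, ℝ) × C(I, ℝ)} (hk : k ∈ InitialData I) {z : ℝ} (hz : z ∈ I),
      (profile hc ho hk).v z = k.1 ⟨z, hz⟩ ∧ (profile hc ho hk).w z = k.2 ⟨z, hz⟩ :=
    fun {k} hk {z} hz => ⟨extend_apply_mem k.1 hz, extend_apply_mem k.2 hz⟩
  have h1 : ∀ z ∈ I, z ∈ Icc (p.1 - p.2 : ℝ) (p.1 + p.2) →
      ((profile hc ho hg).v z ≤ (profile hc ho hf).v z + c ∧
        (profile hc ho hg).w z ≤ (profile hc ho hf).w z + c) ∧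
      ((profile hc ho hf).v z ≤ (profile hc ho hg).v z + c ∧
        (profile hc ho hf).w z ≤ (profile hc ho hg).w z + c) := by
    intro z hz hzw
    rw [(hev hf hz).1, (hev hf hz).2, (hev hg hz).1, (hev hg hz).2]
    obtain ⟨ha, hb⟩ := h ⟨z, hz⟩ hzw
    rw [abs_le] at ha hb
    refine ⟨⟨?_, ?_⟩, ?_, ?_⟩ <;> linarith
  have k1 := V_le_of_data_le (P := profile hc ho hf) (Q := profile hc ho hg) rfl hle hi
    (fun z hz hzw => (h1 z hz hzw).1.1) (fun z hz hzw => (h1 z hz hzw).1.2)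
  have k2 := W_le_of_data_le (P := profile hc ho hf) (Q := profile hc ho hg) rfl hle hi
    (fun z hz hzw => (h1 z hz hzw).1.1) (fun z hz hzw => (h1 z hz hzw).1.2)
  have k3 := V_le_of_data_le (P := profile hc ho hg) (Q := profile hc ho hf) rfl hle hi
    (fun z hz hzw => (h1 z hz hzw).2.1) (fun z hz hzw => (h1 z hz hzw).2.2)
  have k4 := W_le_of_data_le (P := profile hc ho hg) (Q := profile hc ho hf) rfl hle hi
    (fun z hz hzw => (h1 z hz hzw).2.1) (fun z hz hzw => (h1 z hz hzw).2.2)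
  rw [(hu p hp).1, (hu p hp).2, (hu' p hp).1, (hu' p hp).2, abs_le, abs_le]
  refine ⟨⟨?_, ?_⟩, ?_, ?_⟩ <;> linarith

end IsFormula

variable (hc ho) in
/-- The solution operator on all initial conditions. -/
theorem exists_solution_operator (hd : I ⊆ closure (interior I)) :
    ∃ T : InitialData I → C(SpaceTime I, ℝ) × C(SpaceTime I, ℝ),
      ∀ f : InitialData I, IsFormula hc ho f.2 (T f) := by
  have : ∀ f : InitialData I, ∃ u, IsFormula hc ho f.2 u := fun f => by
    obtain ⟨v, hv⟩ := exists_extension_V hc ho f.2 hd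
    obtain ⟨w, hw⟩ := exists_extension_W hc ho f.2 hd
    exact ⟨(v, w), fun p hp => ⟨hv p hp, hw p hp⟩⟩
  exact ⟨fun f => (this f).choose, fun f => (this f).choose_spec⟩

end Construction

/-! ### Contraction in the extended supremum distance -/

theorem edist_le_supDist {α : Type*} [TopologicalSpace α] {B : Set α} {f g : C(α, ℝ) × C(α, ℝ)}
    {x : α} (hx : x ∈ B) :
    edist (f.1 x) (g.1 x) ≤ supDist B f g ∧ edist (f.2 x) (g.2 x) ≤ supDist B f g :=
  max_le_iff.1 (le_iSup₂ (f := fun x (_ : x ∈ B) =>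
    max (edist (f.1 x) (g.1 x)) (edist (f.2 x) (g.2 x))) x hx)

theorem edist_le_iff_abs_sub_le {a b : ℝ} {D : ℝ≥0∞} (hD : D ≠ ⊤) :
    edist a b ≤ D ↔ |a - b| ≤ D.toReal := by
  rw [edist_dist, Real.dist_eq, ENNReal.ofReal_le_iff_le_toReal hD]

theorem IsFormula.max_edist_le {hc : IsClosed I} {ho : I.OrdConnected} {f g : C(I, ℝ) × C(I, ℝ)}
    {hf : f ∈ InitialData I} {hg : g ∈ InitialData I} {u u' : C(SpaceTime I, ℝ) × C(SpaceTime I, ℝ)}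
    (hu : IsFormula hc ho hf u) (hu' : IsFormula hc ho hg u') {p : SpaceTime I}
    (hp : (p.1 : ℝ) ∈ interior I) {B : Set I}
    (hB : ∀ z : I, (z : ℝ) ∈ Icc (p.1 - p.2 : ℝ) (p.1 + p.2) → z ∈ B) :
    max (edist (u.1 p) (u'.1 p)) (edist (u.2 p) (u'.2 p)) ≤ supDist B f g := by
  rcases eq_or_ne (supDist B f g) ⊤ with hD | hD
  · rw [hD]; exact le_top
  · obtain ⟨h1, h2⟩ := hu.abs_sub_le hu' hp (c := (supDist B f g).toReal) fun z hz =>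
      ⟨(edist_le_iff_abs_sub_le hD).1 (edist_le_supDist (hB z hz)).1,
        (edist_le_iff_abs_sub_le hD).1 (edist_le_supDist (hB z hz)).2⟩
    exact max_le ((edist_le_iff_abs_sub_le hD).2 h1) ((edist_le_iff_abs_sub_le hD).2 h2)

theorem IsFormula.supDist_univ_le {hc : IsClosed I} {ho : I.OrdConnected}
    {f g : C(I, ℝ) × C(I, ℝ)} {hf : f ∈ InitialData I} {hg : g ∈ InitialData I}
    {u u' : C(SpaceTime I, ℝ) × C(SpaceTime I, ℝ)} (hd : I ⊆ closure (interior I))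
    (hu : IsFormula hc ho hf u) (hu' : IsFormula hc ho hg u') :
    supDist univ u u' ≤ supDist univ f g := by
  refine iSup₂_le fun p _ => ?_
  exact closure_minimal (s := {p : SpaceTime I | (p.1 : ℝ) ∈ interior I})
    (t := {p | max (edist (u.1 p) (u'.1 p)) (edist (u.2 p) (u'.2 p)) ≤ supDist univ f g})
    (fun p hp => hu.max_edist_le hu' hp fun _ _ => mem_univ _)
    (isClosed_le (by fun_prop) continuous_const) (dense_interior_spaceTime hd p)

/-! ### Density of regular data on a compact interval -/

section Density

variable {a₁ a₂ : ℝ}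

/-- Away from the endpoints, a local extremum is a root of the nonzero derivative. -/
theorem finite_isLocalExtr_eval {p : ℝ[X]} (hp : derivative p ≠ 0) :
    {x : Icc a₁ a₂ | IsLocalExtr (fun z : Icc a₁ a₂ => p.eval (z : ℝ)) x}.Finite := by
  have hfin : ({x : ℝ | (derivative p).IsRoot x} ∪ {a₁, a₂}).Finite :=
    (finite_setOfPred_isRoot hp).union (toFinite _)
  refine (hfin.preimage Subtype.val_injective.injOn).subset fun x hx => ?_
  by_cases h : (x : ℝ) ∈ ({a₁, a₂} : Set ℝ)
  · exact Or.inr h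
  · left
    simp only [mem_insert_iff, mem_singleton_iff, not_or] at h
    have hn : Icc a₁ a₂ ∈ 𝓝 (x : ℝ) :=
      Icc_mem_nhds (x.2.1.lt_of_ne (Ne.symm h.1)) (x.2.2.lt_of_ne h.2)
    have hmap : map ((↑) : Icc a₁ a₂ → ℝ) (𝓝 x) = 𝓝 (x : ℝ) :=
      map_nhds_subtype_coe_eq_nhds x.2 hn
    have hloc : IsLocalExtr (fun z : ℝ => p.eval z) x := by
      rcases hx with hx | hx
      · left
        change ∀ᶠ z in 𝓝 (x : ℝ), p.eval (x : ℝ) ≤ p.eval z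
        rw [← hmap]
        exact hx
      · right
        change ∀ᶠ z in 𝓝 (x : ℝ), p.eval z ≤ p.eval (x : ℝ)
        rw [← hmap]
        exact hx
    have := hloc.deriv_eq_zero
    rwa [Polynomial.deriv] at this

theorem exists_lipschitzWith_eval (p : ℝ[X]) :
    ∃ K : ℝ≥0, LipschitzWith K (fun z : Icc a₁ a₂ => p.eval (z : ℝ)) := by
  have h : LocallyLipschitz (fun z : ℝ => p.eval z) :=
    ContDiff.locallyLipschitz (𝕂 := ℝ)
      (by simpa [coe_aeval_eq_eval] using p.contDiff_aeval (𝕜 := ℝ) 1)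
  obtain ⟨K, hK⟩ := h.locallyLipschitzOn.exists_lipschitzOnWith_of_compact
    (isCompact_Icc (a := a₁) (b := a₂))
  exact ⟨K, hK.to_restrict⟩

/-- A nonnegative function which vanishes at the endpoints is approximated by squares of
polynomials which vanish there. -/
theorem exists_polynomial_sq_near (ha : a₁ < a₂) {d : ℝ → ℝ} (hd : ContinuousOn d (Icc a₁ a₂))
    (hd0 : ∀ x ∈ Icc a₁ a₂, 0 ≤ d x) (h1 : d a₁ = 0) (h2 : d a₂ = 0) {e : ℝ} (he : 0 < e) :
    ∃ q : ℝ[X], q.eval a₁ = 0 ∧ q.eval a₂ = 0 ∧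
      ∀ x ∈ Icc a₁ a₂, |q.eval x ^ 2 - d x| ≤ e := by
  have hs : ContinuousOn (fun x => √(d x)) (Icc a₁ a₂) := hd.sqrt
  obtain ⟨M, hM⟩ := isCompact_Icc.bddAbove_image hs
  have hM' : ∀ x ∈ Icc a₁ a₂, √(d x) ≤ M := fun x hx => hM (mem_image_of_mem _ hx)
  have hM0 : 0 ≤ M := (Real.sqrt_nonneg _).trans (hM' a₁ ⟨le_rfl, ha.le⟩)
  -- With q = p - ℓ below, |q - √d| ≤ 2δ and |q + √d| ≤ 2(M + 1); their product bounds |q² - d|.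
  obtain ⟨δ, hδ, hδ1, hδe⟩ : ∃ δ > 0, δ ≤ 1 ∧ δ * (4 * (M + 1)) ≤ e := by
    refine ⟨min 1 (e / (4 * (M + 1))), by positivity, min_le_left _ _, ?_⟩
    rw [← le_div_iff₀ (by positivity)]
    exact min_le_right _ _
  obtain ⟨p, hp⟩ := exists_polynomial_near_of_continuousOn a₁ a₂ _ hs δ hδ
  have hp1 := hp a₁ ⟨le_rfl, ha.le⟩
  have hp2 := hp a₂ ⟨ha.le, le_rfl⟩
  simp only [h1, h2, Real.sqrt_zero, sub_zero] at hp1 hp2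
  have hne : a₂ - a₁ ≠ 0 := by linarith
  -- The linear interpolation of p at the endpoints; subtracting it makes p vanish there at the cost
  -- of another δ.
  set ℓ : ℝ[X] := C (p.eval a₁ / (a₂ - a₁)) * (C a₂ - X) + C (p.eval a₂ / (a₂ - a₁)) * (X - C a₁)
    with hℓ
  have hℓx : ∀ x, ℓ.eval x = (p.eval a₁ * (a₂ - x) + p.eval a₂ * (x - a₁)) / (a₂ - a₁) := by
    intro x
    simp only [hℓ, eval_add, eval_mul, eval_C, eval_sub, eval_X]
    ring
  have hℓδ : ∀ x ∈ Icc a₁ a₂, |ℓ.eval x| ≤ δ := by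
    intro x hx
    rw [hℓx, abs_div, abs_of_pos (by linarith : 0 < a₂ - a₁), div_le_iff₀ (by linarith)]
    rw [abs_lt] at hp1 hp2
    rw [abs_le]
    constructor <;> nlinarith [hx.1, hx.2]
  refine ⟨p - ℓ, ?_, ?_, fun x hx => ?_⟩
  · rw [eval_sub, hℓx]; field_simp; ring
  · rw [eval_sub, hℓx]; field_simp; ring
  · have h3 := hp x hx
    have h4 := hℓδ x hx
    have h5 := hM' x hx
    have h6 := Real.sqrt_nonneg (d x)
    have h7 := Real.sq_sqrt (hd0 x hx)
    rw [abs_lt] at h3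
    rw [abs_le] at h4
    have h8 : |(p - ℓ).eval x - √(d x)| ≤ 2 * δ := by
      rw [eval_sub, abs_le]
      constructor <;> linarith
    have h9 : |(p - ℓ).eval x + √(d x)| ≤ 2 * (M + 1) := by
      rw [abs_le] at h8 ⊢
      constructor <;> linarith
    calc |(p - ℓ).eval x ^ 2 - d x|
        = |(p - ℓ).eval x - √(d x)| * |(p - ℓ).eval x + √(d x)| := by
          rw [← abs_mul]; congr 1; nlinarith
      _ ≤ 2 * δ * (2 * (M + 1)) := mul_le_mul h8 h9 (abs_nonneg _) (by linarith)
      _ ≤ e := by linarith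

/-- With w near p and v - w near q², the order and the equality at the endpoints hold exactly.
Adding the same ηX to both components preserves this and makes both derivatives nonzero. The error
budget is e/2 for q² and e/4 each for p and ηX. -/
theorem exists_regularData_near (ha : a₁ < a₂) {f : C(Icc a₁ a₂, ℝ) × C(Icc a₁ a₂, ℝ)}
    (hf : f ∈ InitialData (Icc a₁ a₂)) {ε : ℝ≥0∞} (hε : 0 < ε) :
    ∃ g ∈ RegularData (Icc a₁ a₂), supDist univ f g < ε := by
  obtain ⟨e, he0, heε⟩ := ENNReal.lt_iff_exists_nnreal_btwn.1 hε
  have he : (0 : ℝ) < e := by exact_mod_cast he0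
  set P := profile isClosed_Icc ordConnected_Icc hf with hP
  have hPv : ∀ x : Icc a₁ a₂, P.v x = f.1 x := fun x => extend_apply_mem f.1 x.2
  have hPw : ∀ x : Icc a₁ a₂, P.w x = f.2 x := fun x => extend_apply_mem f.2 x.2
  have hm1 : a₁ ∈ Icc a₁ a₂ := ⟨le_rfl, ha.le⟩
  have hm2 : a₂ ∈ Icc a₁ a₂ := ⟨ha.le, le_rfl⟩
  obtain ⟨q, hq1, hq2, hq⟩ := exists_polynomial_sq_near ha (P.contV.sub P.contW)
    (fun x hx => sub_nonneg.2 (P.le x hx))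
    (sub_eq_zero.2 (P.eqLow a₁ hm1 fun _ h => h.1)) (sub_eq_zero.2 (P.eqHigh a₂ hm2 fun _ h => h.2))
    (half_pos he)
  obtain ⟨p, hp⟩ := exists_polynomial_near_of_continuousOn a₁ a₂ _ P.contW (e / 4) (by linarith)
  obtain ⟨η, ⟨hη0, hηe⟩, hη1, hη2⟩ : ∃ η ∈ Ioo 0 (e / 4 / (|a₁| + |a₂| + 1)),
      derivative (p + C η * X) ≠ 0 ∧ derivative (p + q ^ 2 + C η * X) ≠ 0 := by
    -- Each polynomial rules out at most one slope η.
    have hbad : ∀ r : ℝ[X], {η : ℝ | derivative (r + C η * X) = 0}.Finite := fun r => by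
      refine Set.Subsingleton.finite fun x hx y hy => ?_
      simp only [mem_ofPred_eq, derivative_add, derivative_mul, derivative_C, zero_mul,
        derivative_X, mul_one, zero_add] at hx hy
      exact C_injective (add_left_cancel (hx.trans hy.symm))
    obtain ⟨η, h1, h2⟩ := ((Ioo_infinite
      (by positivity : 0 < (e : ℝ) / 4 / (|a₁| + |a₂| + 1))).sdiff
      ((hbad p).union (hbad (p + q ^ 2)))).nonempty
    exact ⟨η, h1, fun h => h2 (Or.inl h), fun h => h2 (Or.inr h)⟩
  have hηx : ∀ x ∈ Icc a₁ a₂, |η * x| ≤ e / 4 := by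
    intro x hx
    have hx' : |x| ≤ |a₁| + |a₂| + 1 := by
      rw [abs_le]
      constructor <;>
        linarith [hx.1, hx.2, neg_abs_le a₁, le_abs_self a₂, abs_nonneg a₁, abs_nonneg a₂]
    rw [lt_div_iff₀ (by positivity)] at hηe
    rw [abs_mul, abs_of_pos hη0]
    exact (mul_le_mul_of_nonneg_left hx' hη0.le).trans hηe.le
  refine ⟨(⟨fun x => (p + q ^ 2 + C η * X).eval (x : ℝ), by fun_prop⟩,
    ⟨fun x => (p + C η * X).eval (x : ℝ), by fun_prop⟩), ⟨⟨fun x => ?_, fun x hx => ?_⟩, ?_,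
    fun l r => ?_⟩, ?_⟩
  · simp only [ContinuousMap.coe_mk, eval_add, eval_pow]
    nlinarith [sq_nonneg (q.eval (x : ℝ))]
  · rw [frontier_Icc ha.le] at hx
    have : q.eval (x : ℝ) = 0 := by
      rcases hx with h | h
      · rw [h, hq1]
      · rw [mem_singleton_iff.1 h, hq2]
    simp [this]
  · obtain ⟨K, hK⟩ := exists_lipschitzWith_eval (a₁ := a₁) (a₂ := a₂) (p + q ^ 2 + C η * X)
    obtain ⟨K', hK'⟩ := exists_lipschitzWith_eval (a₁ := a₁) (a₂ := a₂) (p + C η * X)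
    exact ⟨max K K', hK.weaken (le_max_left _ _), hK'.weaken (le_max_right _ _)⟩
  · refine ((finite_isLocalExtr_eval (a₁ := a₁) (a₂ := a₂) hη2).union
      (finite_isLocalExtr_eval (a₁ := a₁) (a₂ := a₂) hη1)).subset fun x hx => hx.2
  · refine lt_of_le_of_lt (iSup₂_le fun x _ => max_le ?_ ?_) heε
    · rw [edist_le_iff_abs_sub_le ENNReal.coe_ne_top, ENNReal.coe_toReal, ← hPv]
      have h1 := abs_lt.1 (hp x x.2)
      have h2 := abs_le.1 (hq x x.2)
      have h3 := abs_le.1 (hηx x x.2)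
      simp only [ContinuousMap.coe_mk, eval_add, eval_pow, eval_mul, eval_C, eval_X]
      simp only [Pi.sub_apply] at h2
      rw [abs_le]
      constructor <;> linarith
    · rw [edist_le_iff_abs_sub_le ENNReal.coe_ne_top, ENNReal.coe_toReal, ← hPw]
      have h1 := abs_lt.1 (hp x x.2)
      have h3 := abs_le.1 (hηx x x.2)
      simp only [ContinuousMap.coe_mk, eval_add, eval_mul, eval_C, eval_X]
      rw [abs_le]
      constructor <;> linarith

end Density

end FreezingTransport
end

theorem theorem6p2 :
    (∀ a₁ a₂ : ℝ, a₁ < a₂ →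
      (∀ f ∈ FreezingTransport.InitialData (Icc a₁ a₂), ∀ ε : ℝ≥0∞, 0 < ε →
        ∃ g ∈ FreezingTransport.RegularData (Icc a₁ a₂),
          FreezingTransport.supDist univ f g < ε) ∧
      ∃ T : FreezingTransport.InitialData (Icc a₁ a₂) →
          C(FreezingTransport.SpaceTime (Icc a₁ a₂), ℝ) ×
            C(FreezingTransport.SpaceTime (Icc a₁ a₂), ℝ),
        (∀ f, f.1 ∈ FreezingTransport.RegularData (Icc a₁ a₂) →
          FreezingTransport.IsConstructedSolution f.1 (T f)) ∧
        (∀ f g, FreezingTransport.supDist univ (T f) (T g)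
          ≤ FreezingTransport.supDist univ f.1 g.1) ∧
        (∀ f, FreezingTransport.IsSolution (T f) ∧
          FreezingTransport.HasInitialValue (T f) f.1)) ∧
    (∃ T : FreezingTransport.InitialData (univ : Set ℝ) →
        C(FreezingTransport.SpaceTime univ, ℝ) ×
          C(FreezingTransport.SpaceTime univ, ℝ),
      (∀ f, f.1 ∈ FreezingTransport.RegularData (univ : Set ℝ) →
        FreezingTransport.IsConstructedSolution f.1 (T f)) ∧
      (∀ a : ℝ, 0 < a → ∀ f g,
        FreezingTransport.supDist
            {p : FreezingTransport.SpaceTime univ | (p.1 : ℝ) ∈ Icc (-a) a ∧ (p.2 : ℝ) ∈ Ico 0 a}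
            (T f) (T g)
          ≤ FreezingTransport.supDist
            {x : (univ : Set ℝ) | (x : ℝ) ∈ Icc (-(2 * a)) (2 * a)} f.1 g.1) ∧
      (∀ f, FreezingTransport.IsSolution (T f) ∧
        FreezingTransport.HasInitialValue (T f) f.1)) := by
  refine ⟨fun a₁ a₂ ha =>
    ⟨fun f hf ε hε => FreezingTransport.exists_regularData_near ha hf hε, ?_⟩, ?_⟩
  · have hd : Icc a₁ a₂ ⊆ closure (interior (Icc a₁ a₂)) := by
      rw [interior_Icc, closure_Ioo ha.ne]
    obtain ⟨T, hT⟩ :=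
      FreezingTransport.exists_solution_operator isClosed_Icc
        (ordConnected_Icc (a := a₁) (b := a₂)) hd
    have hs := fun f => (hT f).isConstructedSolution hd
    exact ⟨T, fun f _ => hs f, fun f g => (hT f).supDist_univ_le hd (hT g),
      fun f => ⟨(hs f).1, (hs f).2.1⟩⟩
  · have hd : (univ : Set ℝ) ⊆ closure (interior univ) := by simp
    obtain ⟨T, hT⟩ := FreezingTransport.exists_solution_operator isClosed_univ ordConnected_univ hd
    have hs := fun f => (hT f).isConstructedSolution hd
    refine ⟨T, fun f _ => hs f, fun a ha f g => iSup₂_le fun p hp => ?_,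
      fun f => ⟨(hs f).1, (hs f).2.1⟩⟩
    refine (hT f).max_edist_le (hT g) (by simp) fun z hz => ?_
    -- The domain of dependence [x - t, x + t] lies in [-2a, 2a] because |x| ≤ a and t < a.
    exact ⟨by linarith [hz.1, hp.1.1, hp.2.2], by linarith [hz.2, hp.1.2, hp.2.2]⟩
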